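/- **Definitions.** Let $G$ be an at most countable abelian group, written additively. All multisets below are finite and non-empty, and sums, sumsets and averages over them count multiplicity. A *$G$-system* is a probability space $(X,\mathcal B,\mu)$, countably generated modulo null sets, with measure-preserving maps $T^g\colon X\to X$ ($g\in G$) such that $T^0=\mathrm{id}$ and $T^{g+h}=T^gT^h$. For $f\colon X\to\mathbb C$ put $T^gf=f\circ T^{-g}$ and $\Delta_{h,h'}f=(T^hf)\,\overline{T^{h'}f}$. For $f\in L^\infty(X)$, a multiset $Q$ in $G$ and an integer $d\ge1$, the Gowers seminorm $\|f\|_{U^d_Q}\ge0$ is defined by $$\|f\|_{U^d_Q}^{2^d}=\mathbb E_{h_1,\dots,h_d,h_1',\dots,h_d'\in Q}\int_X\Delta_{h_1,h_1'}\cdots\Delta_{h_d,h_d'}f\,d\mu .$$ A *coset progression of rank $r\ge0$* in $G$ is a multiset $Q=H+\{n_1v_1+\dots+n_rv_r: n_i\in\mathbb Z,\ |n_i|\le N_i\ \forall i\}$ together with its data: a finite subgroup $H\le G$, viewed as a multiset in which all elements have the same positive multiplicity, elements $v_1,\dots,v_r\in G$ and real numbers $N_1,\dots,N_r>0$. For $\varepsilon>0$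 its dilate is $\varepsilon Q=H+\{n_1v_1+\dots+n_rv_r:n_i\in\mathbb Z,\ |n_i|\le\varepsilon N_i\ \forall i\}$. If $Q_1,Q_2$ are coset progressions of ranks $r_1,r_2$, with subgroups $H_1,H_2$, then the sumset $Q_1+Q_2$ is a coset progression of rank $r_1+r_2$, with subgroup $H_1+H_2$ and with the generators $v_i$ and the bounds $N_i$ of $Q_1$ followed by those of $Q_2$. For $f\in L^\infty(X)$ and $\varepsilon>0$ put $$\|f\|_{U^d_Q{}^{*},\varepsilon}=\sup\Big\{\Big|\int_Xf\,\overline g\,d\mu\Big| : g\in L^\infty(X),\ \|g\|_{L^\infty}\le1,\ \|g\|_{U^d_{\varepsilon Q}}\le\varepsilon\Big\}.$$ **Theorem 1.6.** Let $d_1,d_2\ge1$ and $r_1,r_2\ge0$ be integers and let $c_1,c_2\colon(0,\infty)\to(0,\infty)$ be functions with $c_i(\varepsilon)\to0$ as $\varepsilon\to0$ for $i=1,2$. Then there is a function $c\colon(0,\infty)\to(0,\infty)$ with $c(\varepsilon)\to0$ as $\varepsilon\to0$, depending only on $d_1,d_2,r_1,r_2,c_1,c_2$, such that the following holds. Let $G$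 be an at most countable abelian group, let $Q_1,Q_2$ be coset progressions in $G$ of ranks $r_1,r_2$, let $(X,T)$ be a $G$-system, and let $f$ lie in the closed unit ball of $L^\infty(X)$. If $$\|f\|_{U^{d_1}_{Q_1}{}^{*},\varepsilon}\le c_1(\varepsilon)\quad\text{and}\quad\|f\|_{U^{d_2}_{Q_2}{}^{*},\varepsilon}\le c_2(\varepsilon)\qquad\text{for all }\varepsilon>0,$$ then $$\|f\|_{U^{d_1+d_2-1}_{Q_1+Q_2}{}^{*},\varepsilon}\le c(\varepsilon)\qquad\text{for all }\varepsilon>0 .$$ -/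

import Mathlib

open MeasureTheory Filter
open scoped ENNReal Topology

universe u v

noncomputable section

/-- The sumset `A + B = {a + b : a ∈ A, b ∈ B}` of two finite multisets, counted with
multiplicity. (The operation `+` on `Multiset` is the union, not the sumset.) -/
def sumset {G : Type u} [AddCommGroup G] (A B : Multiset G) : Multiset G :=
  (A ×ˢ B).map fun p => p.1 + p.2

/-- The average `𝔼_{a ∈ A} F a` over a finite multiset, counted with multiplicity. -/
def multisetAvg {α : Type u} (A : Multiset α) (F : α → ℂ) : ℂ :=
  (A.map F).sum / (A.card : ℂ)

/-- The finite set of all integer vectors `n` with `|n i| ≤ N i` for all `i`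
(see `mem_integerBox`). -/
def integerBox {r : ℕ} (N : Fin r → ℝ) : Finset (Fin r → ℤ) :=
  Fintype.piFinset fun i => Finset.Icc (-⌊N i⌋) ⌊N i⌋

theorem mem_integerBox {r : ℕ} (N : Fin r → ℝ) (n : Fin r → ℤ) :
    n ∈ integerBox N ↔ ∀ i, |(n i : ℝ)| ≤ N i := by
  simp only [integerBox, Fintype.mem_piFinset, Finset.mem_Icc, abs_le]
  refine forall_congr' fun i => and_congr ?_ Int.le_floor
  rw [neg_le, Int.le_floor, Int.cast_neg, neg_le]

/-- The data `(H, (v i), (N i))` of a (symmetric) coset progression of rank `r` in `G`. The finite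
subgroup `H` is viewed as a multiset in which every element has the same multiplicity `mult`. -/
structure CosetProgression (G : Type u) [AddCommGroup G] (r : ℕ) where
  H : AddSubgroup G
  finite_H : (H : Set G).Finite
  mult : ℕ
  mult_pos : 0 < mult
  v : Fin r → G
  N : Fin r → ℝ
  N_pos : ∀ i, 0 < N i

namespace CosetProgression

variable {G : Type u} [AddCommGroup G] {r r₁ r₂ : ℕ}

/-- The multiset `H + {n₁ v₁ + ⋯ + n_r v_r : |n i| ≤ N i}`, counted with multiplicity. -/
def toMultiset (Q : CosetProgression G r) : Multiset G :=
  sumset (Q.mult • Q.finite_H.toFinset.val)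
    ((integerBox Q.N).val.map fun n => ∑ i, n i • Q.v i)

/-- The dilate `ε Q = H + {n₁ v₁ + ⋯ + n_r v_r : |n i| ≤ ε N i}` of a coset progression. -/
def dilate (Q : CosetProgression G r) (ε : ℝ) (hε : 0 < ε) : CosetProgression G r where
  H := Q.H
  finite_H := Q.finite_H
  mult := Q.mult
  mult_pos := Q.mult_pos
  v := Q.v
  N := fun i => ε * Q.N i
  N_pos := fun i => mul_pos hε (Q.N_pos i)

theorem finite_sup (H₁ H₂ : AddSubgroup G) (h₁ : (H₁ : Set G).Finite) (h₂ : (H₂ : Set G).Finite) :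
    ((H₁ ⊔ H₂ : AddSubgroup G) : Set G).Finite := by
  rw [AddSubgroup.add_normal]
  exact h₁.add h₂

/-- The sum `Q₁ + Q₂`, a coset progression of rank `r₁ + r₂`. Each element of the subgroup
`H₁ + H₂` is a sum `h₁ + h₂` in `|H₁ ∩ H₂|` ways, which accounts for the field `mult`. The
underlying multiset is the sumset of those of `Q₁` and `Q₂` (see `toMultiset_add`). -/
def add (Q₁ : CosetProgression G r₁) (Q₂ : CosetProgression G r₂) :
    CosetProgression G (r₁ + r₂) where
  H := Q₁.H ⊔ Q₂.H
  finite_H := finite_sup Q₁.H Q₂.H Q₁.finite_H Q₂.finite_H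
  mult := Q₁.mult * Q₂.mult * Nat.card (Q₁.H ⊓ Q₂.H : AddSubgroup G)
  mult_pos := by
    have : Finite (Q₁.H ⊓ Q₂.H : AddSubgroup G) :=
      (Q₁.finite_H.subset (fun x hx => hx.1) : ((Q₁.H ⊓ Q₂.H : AddSubgroup G) : Set G).Finite)
    exact Nat.mul_pos (Nat.mul_pos Q₁.mult_pos Q₂.mult_pos) Nat.card_pos
  v := Fin.append Q₁.v Q₂.v
  N := Fin.append Q₁.N Q₂.N
  N_pos := fun i => by
    refine Fin.addCases (fun j => ?_) (fun j => ?_) i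
    · simpa using Q₁.N_pos j
    · simpa using Q₂.N_pos j

theorem sumset_subgroup (H₁ H₂ : AddSubgroup G) (h₁ : (H₁ : Set G).Finite)
    (h₂ : (H₂ : Set G).Finite) :
    sumset h₁.toFinset.val h₂.toFinset.val =
      Nat.card (H₁ ⊓ H₂ : AddSubgroup G) • (finite_sup H₁ H₂ h₁ h₂).toFinset.val := by
  classical
  ext x
  rw [sumset, ← Finset.product_val, Multiset.count_map, Multiset.count_nsmul, ← Finset.filter_val,
    Finset.card_val]
  by_cases hx : x ∈ H₁ ⊔ H₂
  · rw [Multiset.count_eq_one_of_mem (Finset.nodup _) (by simpa using hx), mul_one]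
    obtain ⟨a, ha, b, hb, rfl⟩ := AddSubgroup.mem_sup.1 hx
    have hfin : Finite (H₁ ⊓ H₂ : AddSubgroup G) :=
      (h₁.subset (fun x hx => hx.1) : ((H₁ ⊓ H₂ : AddSubgroup G) : Set G).Finite)
    have := Fintype.ofFinite (H₁ ⊓ H₂ : AddSubgroup G)
    rw [Nat.card_eq_fintype_card, ← Finset.card_univ]
    symm
    refine Finset.card_bij (fun c _ => (a + (c : G), b - (c : G))) ?_ ?_ ?_
    · rintro ⟨c, hc⟩ -
      have hc1 : c ∈ H₁ := hc.1
      have hc2 : c ∈ H₂ := hc.2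
      simp [H₁.add_mem ha hc1, H₂.sub_mem hb hc2]
    · rintro c - c' - h
      simpa using congrArg Prod.fst h
    · rintro ⟨a', b'⟩ h
      simp only [Finset.mem_filter, Finset.mem_product, Set.Finite.mem_toFinset,
        SetLike.mem_coe] at h
      obtain ⟨⟨ha', hb'⟩, hab⟩ := h
      have e : a' - a = b - b' := by
        rw [sub_eq_sub_iff_add_eq_add, ← hab, add_comm]
      refine ⟨⟨a' - a, H₁.sub_mem ha' ha, ?_⟩, Finset.mem_univ _, ?_⟩
      · rw [e]; exact H₂.sub_mem hb hb'
      · have e' : a + (b - b') = a' := by rw [← e]; abel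
        ext <;> simp [e, e']
  · rw [Multiset.count_eq_zero_of_notMem (by simpa using hx), mul_zero, Finset.card_eq_zero,
      Finset.filter_eq_empty_iff]
    rintro ⟨a, b⟩ hab rfl
    simp only [Finset.mem_product, Set.Finite.mem_toFinset, SetLike.mem_coe] at hab
    exact hx (AddSubgroup.add_mem_sup hab.1 hab.2)

theorem sumset_add_left (A A' B : Multiset G) :
    sumset (A + A') B = sumset A B + sumset A' B := by
  simp [sumset, Multiset.add_product]

theorem sumset_add_right (A B B' : Multiset G) :
    sumset A (B + B') = sumset A B + sumset A B' := by
  simp [sumset, Multiset.product_add]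

theorem sumset_nsmul_nsmul (m n : ℕ) (A B : Multiset G) :
    sumset (m • A) (n • B) = (m * n) • sumset A B := by
  have h1 : ∀ B : Multiset G, sumset (m • A) B = m • sumset A B := fun B => by
    induction m with
    | zero => simp [sumset]
    | succ m ih => simp only [succ_nsmul, sumset_add_left, ih]
  have h2 : sumset A (n • B) = n • sumset A B := by
    induction n with
    | zero => simp [sumset]
    | succ n ih => simp only [succ_nsmul, sumset_add_right, ih]
  rw [h1, h2, mul_nsmul']

theorem sumset_singleton_left (x : G) (S : Multiset G) : sumset {x} S = S.map (x + ·) := by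
  change (({x} : Multiset G).bind fun a => S.map (Prod.mk a)).map _ = _
  simp

theorem sumset_map_map {α β : Type*} (S : Multiset α) (T : Multiset β) (f : α → G) (g : β → G) :
    sumset (S.map f) (T.map g) = (S ×ˢ T).map fun p => f p.1 + g p.2 := by
  induction S using Multiset.induction_on with
  | empty => simp [sumset]
  | cons a S ih =>
    rw [← Multiset.singleton_add, Multiset.map_add, sumset_add_left, ih, Multiset.add_product,
      Multiset.map_add]
    congr 1
    change _ = (({a} : Multiset α).bind fun a => T.map (Prod.mk a)).map _
    simp [sumset_singleton_left]

theorem sumset_sumset_comm (A B C D : Multiset G) :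
    sumset (sumset A B) (sumset C D) = sumset (sumset A C) (sumset B D) := by
  induction A using Multiset.induction_on with
  | empty => simp [sumset]
  | cons a A ih =>
    rw [← Multiset.singleton_add a A]
    simp only [sumset_add_left, ih]
    congr 1
    clear ih
    induction C using Multiset.induction_on with
    | empty => simp [sumset]
    | cons c C ih =>
      rw [← Multiset.singleton_add c C]
      simp only [sumset_add_left, sumset_add_right, ih]
      congr 1
      simp only [sumset_singleton_left, Multiset.map_singleton, sumset_map_map]
      rw [sumset, Multiset.map_map]
      refine Multiset.map_congr rfl fun p _ => ?_
      simp only [Function.comp_apply]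
      abel

theorem integerBox_append (N₁ : Fin r₁ → ℝ) (N₂ : Fin r₂ → ℝ) :
    integerBox (Fin.append N₁ N₂) =
      (integerBox N₁ ×ˢ integerBox N₂).map (Fin.appendEquiv r₁ r₂).toEmbedding := by
  ext n
  obtain ⟨⟨a, b⟩, rfl⟩ := (Fin.appendEquiv (α := ℤ) r₁ r₂).surjective n
  simp [mem_integerBox, Fin.forall_fin_add]

theorem toMultiset_add (Q₁ : CosetProgression G r₁) (Q₂ : CosetProgression G r₂) :
    (Q₁.add Q₂).toMultiset = sumset Q₁.toMultiset Q₂.toMultiset := by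
  simp only [toMultiset]
  rw [sumset_sumset_comm, sumset_nsmul_nsmul, sumset_subgroup, sumset_map_map]
  simp only [add, integerBox_append, Finset.map_val, Multiset.map_map, Finset.product_val,
    mul_nsmul']
  congr 1
  refine Multiset.map_congr rfl fun p _ => ?_
  simp [Fin.sum_univ_add]

theorem dilate_add (Q₁ : CosetProgression G r₁) (Q₂ : CosetProgression G r₂) (ε : ℝ)
    (hε : 0 < ε) : (Q₁.add Q₂).dilate ε hε = (Q₁.dilate ε hε).add (Q₂.dilate ε hε) := by
  simp only [add, dilate, mk.injEq, true_and]
  funext i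
  refine Fin.addCases (fun j => ?_) (fun j => ?_) i <;> simp

end CosetProgression

/-- A measure space is countably generated modulo null sets if some countable family of measurable
sets generates a `σ`-algebra that contains every measurable set up to a null set. -/
def CountablyGeneratedModNull {X : Type v} [MeasurableSpace X] (μ : Measure X) : Prop :=
  ∃ S : Set (Set X), S.Countable ∧ (∀ s ∈ S, MeasurableSet s) ∧
    ∀ A : Set X, MeasurableSet A →
      ∃ B : Set X, MeasurableSet[MeasurableSpace.generateFrom S] B ∧ A =ᵐ[μ] B

/-- `(X, μ)` with the action `T^g x = g +ᵥ x` of `G` is a `G`-system: a probability space, countably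
generated modulo null sets, on which every `T^g` is measurable and measure preserving. The laws
`T^0 = id`, `T^{g+h} = T^g T^h` (and hence invertibility) are those of `AddAction`. -/
structure IsGSystem (G : Type u) [AddCommGroup G] {X : Type v} [MeasurableSpace X] [AddAction G X]
    (μ : Measure X) : Prop where
  isProbabilityMeasure : IsProbabilityMeasure μ
  measurePreserving : ∀ g : G, MeasurePreserving (fun x : X => g +ᵥ x) μ μ
  countablyGenerated : CountablyGeneratedModNull μ

section GowersNorm

variable {G : Type u} [AddCommGroup G] {X : Type v} [MeasurableSpace X] [AddAction G X]

/-- The translate `T^g f = f ∘ T^{-g}`, where `T^g x = g +ᵥ x`. -/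
def actionTranslate (g : G) (f : X → ℂ) : X → ℂ := fun x => f (-g +ᵥ x)

/-- The nonlinear operator `Δ_{h,h'} f = (T^h f) · conj (T^{h'} f)`. -/
def gowersDelta (h h' : G) (f : X → ℂ) : X → ℂ :=
  fun x => actionTranslate h f x * starRingEnd ℂ (actionTranslate h' f x)

/-- The average
`𝔼_{h₁,…,h_d,h₁',…,h_d' ∈ Q} ∫ Δ_{h₁,h₁'} ⋯ Δ_{h_d,h_d'} f dμ`,
as an iterated average over the pairs `(h i, h i') ∈ Q × Q`. -/
def gowersAvg (μ : Measure X) (Q : Multiset G) : ℕ → (X → ℂ) → ℂ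
  | 0, f => ∫ x, f x ∂μ
  | d + 1, f => multisetAvg (Q ×ˢ Q) fun p => gowersAvg μ Q d (gowersDelta p.1 p.2 f)

/-- The local Gowers uniformity seminorm `‖f‖_{U^d_Q}`, defined by
`‖f‖_{U^d_Q} ^ (2 ^ d) = gowersAvg μ Q d f`; for `d ≥ 1` and bounded `f` the right-hand side is
real and nonnegative, so that it equals its absolute value (see `gowersNorm_pow`). -/
def gowersNorm (μ : Measure X) (d : ℕ) (Q : Multiset G) (f : X → ℂ) : ℝ :=
  ‖gowersAvg μ Q d f‖ ^ ((1 : ℝ) / 2 ^ d)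

open scoped ComplexOrder in
theorem gowersAvg_nonneg {μ : Measure X} (hX : IsGSystem G μ) (Q : Multiset G) (d : ℕ) :
    ∀ f : X → ℂ, MemLp f ∞ μ → 0 ≤ gowersAvg μ Q (d + 1) f := by
  have := hX.isProbabilityMeasure
  have htr : ∀ (g : G) (f : X → ℂ), MemLp f ∞ μ → MemLp (actionTranslate g f) ∞ μ :=
    fun g f hf => hf.comp_measurePreserving (hX.measurePreserving (-g))
  have hmul : ∀ (h h' : G) (f : X → ℂ), MemLp f ∞ μ → MemLp (gowersDelta h h' f) ∞ μ :=
    fun h h' f hf => (htr h' f hf).star.mul (htr h f hf)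
  have havg : ∀ (A : Multiset (G × G)) (F : G × G → ℂ), (∀ p, 0 ≤ F p) → 0 ≤ multisetAvg A F := by
    intro A F hF
    rw [multisetAvg, div_eq_mul_inv, ← Complex.ofReal_natCast, ← Complex.ofReal_inv]
    refine mul_nonneg (Multiset.sum_nonneg ?_) (Complex.zero_le_real.2 (by positivity))
    simp only [Multiset.mem_map, forall_exists_index, and_imp]
    rintro _ p - rfl
    exact hF p
  induction d with
  | succ d ih => exact fun f hf => havg _ _ fun p => ih _ (hmul _ _ f hf)
  | zero =>
    intro f hf
    obtain ⟨n, q, rfl⟩ : ∃ (n : ℕ) (q : Fin n → G), Q = Finset.univ.val.map q := by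
      induction Q using Quotient.inductionOn with
      | h l => exact ⟨l.length, l.get, by simp⟩
    simp only [gowersAvg, multisetAvg]
    rw [div_eq_mul_inv, ← Complex.ofReal_natCast, ← Complex.ofReal_inv]
    refine mul_nonneg ?_ (Complex.zero_le_real.2 (by positivity))
    have key : ((Multiset.map q Finset.univ.val ×ˢ Multiset.map q Finset.univ.val).map
        fun p => ∫ x, gowersDelta p.1 p.2 f x ∂μ).sum =
        ∫ x, ((‖∑ i, actionTranslate (q i) f x‖ ^ 2 : ℝ) : ℂ) ∂μ := by
      have e : ∀ x, ((‖∑ i, actionTranslate (q i) f x‖ ^ 2 : ℝ) : ℂ) =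
          ∑ i, ∑ j, gowersDelta (q i) (q j) f x := by
        intro x
        rw [← Complex.normSq_eq_norm_sq, ← Complex.mul_conj, map_sum, Finset.sum_mul_sum]
        rfl
      have hint : ∀ i j, Integrable (gowersDelta (q i) (q j) f) μ := fun i j =>
        (hmul _ _ f hf).integrable le_top
      simp only [e]
      rw [integral_finsetSum _ fun i _ => integrable_finsetSum _ fun j _ => hint i j]
      simp only [integral_finsetSum _ fun j _ => hint _ j]
      have hs : ∀ (S T : Multiset G) (F : G × G → ℂ), ((S ×ˢ T).map F).sum =
          (S.map fun a => (T.map fun b => F (a, b)).sum).sum := fun S T F => by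
        change ((S.bind fun a => T.map (Prod.mk a)).map F).sum = _
        simp [Multiset.map_bind, Multiset.sum_bind]
      rw [hs]
      simp only [Multiset.map_map, Function.comp_def, Finset.sum]
    rw [key, integral_complex_ofReal]
    exact Complex.zero_le_real.2 (integral_nonneg fun x => by positivity)

open scoped ComplexOrder in
theorem gowersNorm_pow {μ : Measure X} (hX : IsGSystem G μ) (Q : Multiset G) {d : ℕ} (hd : 0 < d)
    {f : X → ℂ} (hf : MemLp f ∞ μ) :
    ((gowersNorm μ d Q f ^ 2 ^ d : ℝ) : ℂ) = gowersAvg μ Q d f := by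
  obtain ⟨d, rfl⟩ := Nat.exists_eq_add_of_lt hd
  rw [zero_add]
  have h : (gowersNorm μ (d + 1) Q f) ^ 2 ^ (d + 1) = ‖gowersAvg μ Q (d + 1) f‖ := by
    rw [gowersNorm, ← Real.rpow_natCast, ← Real.rpow_mul (norm_nonneg _)]
    simp
  rw [h]
  exact Complex.norm_of_nonneg' (gowersAvg_nonneg hX Q d f hf)

/-- The dual quantity `‖f‖_{U^d_Q^*, ε}`: the supremum of `|⟨f, g⟩|`, `⟨f, g⟩ = ∫ f · conj g dμ`,
over all `g ∈ L^∞` with `‖g‖_{L^∞} ≤ 1` and `‖g‖_{U^d_{ε Q}} ≤ ε`. -/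
def gowersDual {r : ℕ} (μ : Measure X) (d : ℕ) (Q : CosetProgression G r) (f : X → ℂ)
    (ε : ℝ) (hε : 0 < ε) : ℝ≥0∞ :=
  ⨆ (g : X → ℂ) (_ : MemLp g ∞ μ) (_ : eLpNorm g ∞ μ ≤ 1)
    (_ : gowersNorm μ d (Q.dilate ε hε).toMultiset g ≤ ε),
    ‖∫ x, f x * starRingEnd ℂ (g x) ∂μ‖ₑ

end GowersNorm

end

/-! The argument works with classes of functions instead of single functions. A `FunctionClass`
assigns a set of functions to each system of a collection, and every estimate is uniform over the
whole class. A class has order `d ≥ 1` along a family of progressions `Q` if its correlations with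
1-bounded `g` satisfying `‖g‖_{U^d_{εQ}} ≤ ε` tend to 0 uniformly as `ε → 0` (`AntiUniform`); order
0 allows only the constant function 1.

The core is a recursive description. A class has order `d + 1` exactly when, for `n` in small
dilates of `Q`, the translates `T^n f` are `L¹`-close to convex combinations of products `c_n h`,
where `c_n` lies in a class of order `d` and `h` lies in a bounded class and does not depend on `n`
(`AlmostPeriodic`).

One direction is Cauchy–Schwarz (`AlmostPeriodic.antiUniform_succ`). Squaring the average over `n`
of `⟨c_n h, T^n g⟩` removes `h` and leaves correlations of `c_n conj(c_n')` with `Δ_{n,n'} g`, which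
has small `U^d` seminorm for most pairs when `g` has small `U^{d+1}` seminorm.

The other direction (`AntiUniform.almostPeriodic`) has two ingredients. The dual functions
`gowersCofactor` are almost periodic, since a small shift of an averaging variable hardly changes
the average (`almostPeriodic_cofactorClass`). An energy decrement then approximates every
anti-uniform function by functions built from dual functions with algebra operations and limits
(`mem_of_antiUniform`). This can be carried out inside any invariant algebra `Y` containing the
class, so that `c_n` and `h` lie in `Y` too.

For the concatenation (`AntiUniform.concatenation`), let `Y` consist of the classes that are
anti-uniform along both `Q₁` and `Q₂`. If `n = a + b`, then, up to convex combinations, `T^a f ≈ c_a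
h` and `T^b h ≈ c'_b h'`, so `T^n f ≈ (T^b c_a · c'_b) h'`. Here `T^b c_a` has lost one order along
`Q₁` and `c'_b` one order along `Q₂`. By induction on the sum of the orders, both have order one
less than the target along `Q₁ + Q₂`, and Cauchy–Schwarz concludes. Applying this to the collection
of all systems and progressions at once makes the final bound uniform. -/

open scoped Pointwise ComplexConjugate

universe w

noncomputable section

/-! ### Averages over multisets as elements of convex sets. -/

section Averages

/-- The average of a vector-valued function over a finite multiset. -/
def vectorAvg {α V : Type*} [AddCommGroup V] [Module ℝ V] (A : Multiset α) (F : α → V) : V :=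
  (A.card : ℝ)⁻¹ • (A.map F).sum

variable {α β V W : Type*} [AddCommGroup V] [Module ℝ V] [AddCommGroup W] [Module ℝ W]

theorem multisetAvg_eq_vectorAvg {α : Type u} (A : Multiset α) (F : α → ℂ) :
    multisetAvg A F = vectorAvg A F := by
  simp [multisetAvg, vectorAvg, div_eq_inv_mul]

theorem exists_eq_map_univ (A : Multiset α) :
    ∃ (N : ℕ) (q : Fin N → α), A = Finset.univ.val.map q := by
  induction A using Quotient.inductionOn with
  | h l => exact ⟨l.length, l.get, by simp⟩

theorem vectorAvg_map_univ {N : ℕ} (q : Fin N → α) (F : α → V) :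
    vectorAvg (Finset.univ.val.map q) F = (N : ℝ)⁻¹ • ∑ i, F (q i) := by
  simp [vectorAvg, Finset.sum, Function.comp_def]

theorem vectorAvg_congr {A : Multiset α} {F F' : α → V} (h : ∀ a ∈ A, F a = F' a) :
    vectorAvg A F = vectorAvg A F' := by
  rw [vectorAvg, vectorAvg, Multiset.map_congr rfl h]

theorem vectorAvg_map (f : β → α) (A : Multiset β) (F : α → V) :
    vectorAvg (A.map f) F = vectorAvg A fun b => F (f b) := by
  simp [vectorAvg]

theorem map_vectorAvg (L : V →ₗ[ℝ] W) (A : Multiset α) (F : α → V) :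
    L (vectorAvg A F) = vectorAvg A fun a => L (F a) := by
  simp [vectorAvg, map_multiset_sum]

theorem vectorAvg_apply {X : Type*} {E : X → Type*} [∀ x, AddCommGroup (E x)]
    [∀ x, Module ℝ (E x)] (A : Multiset α) (F : α → ∀ x, E x) (x : X) :
    vectorAvg A F x = vectorAvg A fun a => F a x :=
  map_vectorAvg (LinearMap.proj x : (∀ x, E x) →ₗ[ℝ] E x) A F

theorem vectorAvg_sub (A : Multiset α) (F F' : α → V) :
    vectorAvg A F - vectorAvg A F' = vectorAvg A fun a => F a - F' a := by
  simp [vectorAvg, Multiset.sum_map_sub, smul_sub]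

theorem vectorAvg_add (A : Multiset α) (F F' : α → V) :
    vectorAvg A (fun a => F a + F' a) = vectorAvg A F + vectorAvg A F' := by
  simp [vectorAvg, Multiset.sum_map_add, smul_add]

theorem vectorAvg_const {A : Multiset α} (hA : A ≠ 0) (v : V) :
    vectorAvg A (fun _ => v) = v := by
  have : (A.card : ℝ) ≠ 0 := by simpa using hA
  simp [vectorAvg, ← Nat.cast_smul_eq_nsmul ℝ, smul_smul, this]

theorem vectorAvg_mem {s : Set V} (hs : Convex ℝ s) {A : Multiset α} (hA : A ≠ 0) {F : α → V}
    (h : ∀ a ∈ A, F a ∈ s) : vectorAvg A F ∈ s := by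
  obtain ⟨N, q, rfl⟩ := exists_eq_map_univ A
  have hN : (N : ℝ) ≠ 0 := by
    rintro h0
    have : N = 0 := by exact_mod_cast h0
    subst this
    simp at hA
  rw [vectorAvg_map_univ, Finset.smul_sum]
  exact hs.sum_mem (fun _ _ => by positivity) (by simp [hN]) fun i _ => h _ (by simp)

theorem norm_vectorAvg_le {E : Type*} [NormedAddCommGroup E] [NormedSpace ℝ E] (A : Multiset α)
    {F : α → E} {M : ℝ} (hM : 0 ≤ M) (h : ∀ a ∈ A, ‖F a‖ ≤ M) : ‖vectorAvg A F‖ ≤ M := by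
  rcases eq_or_ne A 0 with rfl | hA
  · simpa [vectorAvg] using hM
  · simpa using vectorAvg_mem (convex_closedBall (0 : E) M) hA (F := F) (by simpa using h)

theorem vectorAvg_mono {A : Multiset α} {F F' : α → ℝ} (h : ∀ a ∈ A, F a ≤ F' a) :
    vectorAvg A F ≤ vectorAvg A F' := by
  simp only [vectorAvg, smul_eq_mul]
  exact mul_le_mul_of_nonneg_left (Multiset.sum_map_le_sum_map _ _ h) (by positivity)

theorem norm_vectorAvg_le_vectorAvg {E : Type*} [NormedAddCommGroup E] [NormedSpace ℝ E]
    (A : Multiset α) (F : α → E) : ‖vectorAvg A F‖ ≤ vectorAvg A fun a => ‖F a‖ := by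
  obtain ⟨N, q, rfl⟩ := exists_eq_map_univ A
  rw [vectorAvg_map_univ, vectorAvg_map_univ, norm_smul, smul_eq_mul]
  have : ‖(N : ℝ)⁻¹‖ = (N : ℝ)⁻¹ := by simp
  rw [this]
  gcongr
  exact norm_sum_le _ _

theorem vectorAvg_product (A : Multiset α) (B : Multiset β) (F : α × β → V) :
    vectorAvg (A ×ˢ B) F = vectorAvg A fun a => vectorAvg B fun b => F (a, b) := by
  have hs : ((A ×ˢ B).map F).sum = (A.map fun a => (B.map fun b => F (a, b)).sum).sum := by
    change ((A.bind fun a => B.map (Prod.mk a)).map F).sum = _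
    simp [Multiset.map_bind, Multiset.sum_bind]
  simp only [vectorAvg, hs, Multiset.card_product, Nat.cast_mul, mul_inv, mul_smul]
  rw [Multiset.smul_sum (r := (B.card : ℝ)⁻¹), Multiset.map_map]
  rfl

theorem mul_vectorAvg (A : Multiset α) (F : α → ℂ) (z : ℂ) :
    z * vectorAvg A F = vectorAvg A fun a => z * F a :=
  map_vectorAvg (LinearMap.mulLeft ℝ z) A F

theorem conj_vectorAvg (A : Multiset α) (F : α → ℂ) :
    conj (vectorAvg A F) = vectorAvg A fun a => conj (F a) :=
  map_vectorAvg Complex.conjAe.toLinearMap A F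

theorem ofReal_vectorAvg (A : Multiset α) (F : α → ℝ) :
    ((vectorAvg A F : ℝ) : ℂ) = vectorAvg A fun a => (F a : ℂ) :=
  map_vectorAvg Complex.ofRealAm.toLinearMap A F

theorem integral_vectorAvg {X : Type*} [MeasurableSpace X] {μ : Measure X} (A : Multiset α)
    {F : α → X → ℂ} (hF : ∀ a, Integrable (F a) μ) :
    ∫ x, vectorAvg A (fun a => F a x) ∂μ = vectorAvg A fun a => ∫ x, F a x ∂μ := by
  obtain ⟨N, q, rfl⟩ := exists_eq_map_univ A
  simp only [vectorAvg_map_univ]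
  rw [integral_smul, integral_finsetSum _ fun i _ => hF _]

end Averages

/-! ### Bounded functions and the `L¹` distance. -/

section BoundedFunctions

variable {X : Type v} [MeasurableSpace X]

/-- A measurable function bounded in norm by `M` everywhere. -/
def BddBy (M : ℝ) (f : X → ℂ) : Prop := Measurable f ∧ ∀ x, ‖f x‖ ≤ M

namespace BddBy

variable {M M' : ℝ} {f g : X → ℂ}

theorem mono (h : M ≤ M') (hf : BddBy M f) : BddBy M' f := ⟨hf.1, fun x => (hf.2 x).trans h⟩

theorem add (hf : BddBy M f) (hg : BddBy M' g) : BddBy (M + M') (f + g) :=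
  ⟨hf.1.add hg.1, fun x => (norm_add_le _ _).trans (add_le_add (hf.2 x) (hg.2 x))⟩

theorem sub (hf : BddBy M f) (hg : BddBy M' g) : BddBy (M + M') (f - g) :=
  ⟨hf.1.sub hg.1, fun x => (norm_sub_le _ _).trans (add_le_add (hf.2 x) (hg.2 x))⟩

theorem mul (hM : 0 ≤ M) (hf : BddBy M f) (hg : BddBy M' g) : BddBy (M * M') (f * g) :=
  ⟨hf.1.mul hg.1, fun x => by
    rw [Pi.mul_apply, norm_mul]
    exact mul_le_mul (hf.2 x) (hg.2 x) (norm_nonneg _) hM⟩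

theorem star (hf : BddBy M f) : BddBy M (star f) :=
  ⟨Complex.continuous_conj.measurable.comp hf.1, fun x => by simpa using hf.2 x⟩

theorem const (c : ℂ) (h : ‖c‖ ≤ M) : BddBy M (fun _ : X => c) := ⟨measurable_const, fun _ => h⟩

theorem integrable {μ : Measure X} [IsFiniteMeasure μ] (hf : BddBy M f) : Integrable f μ :=
  Integrable.of_bound hf.1.aestronglyMeasurable M (.of_forall hf.2)

theorem memLp {μ : Measure X} (hf : BddBy M f) : MemLp f ∞ μ :=
  memLp_top_of_bound hf.1.aestronglyMeasurable M (.of_forall hf.2)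

theorem convex (M : ℝ) : Convex ℝ {f : X → ℂ | BddBy M f} := by
  intro f hf g hg a b ha hb hab
  refine ⟨(hf.1.const_smul a).add (hg.1.const_smul b), fun x => ?_⟩
  have := convex_closedBall (0 : ℂ) M (x := f x) (by simpa using hf.2 x) (y := g x)
    (by simpa using hg.2 x) ha hb hab
  simpa using this

theorem norm_integral_le {μ : Measure X} [IsProbabilityMeasure μ] (hf : BddBy M f) :
    ‖∫ x, f x ∂μ‖ ≤ M := by
  simpa using norm_integral_le_of_norm_le_const (μ := μ) (.of_forall hf.2)

end BddBy

/-- The `L¹` distance. -/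
def l1Dist (μ : Measure X) (f g : X → ℂ) : ℝ := ∫ x, ‖f x - g x‖ ∂μ

section L1Dist

variable {μ : Measure X} {M M' B B' κ : ℝ} {f f' g g' h : X → ℂ}

theorem l1Dist_self : l1Dist μ f f = 0 := by simp [l1Dist]

theorem l1Dist_star : l1Dist μ (star f) (star g) = l1Dist μ f g := by
  refine integral_congr_ae (.of_forall fun x => ?_)
  change ‖star (f x) - star (g x)‖ = _
  rw [← star_sub, norm_star]

theorem l1Dist_smul {a : ℝ} (ha : 0 ≤ a) : l1Dist μ (a • f) (a • g) = a * l1Dist μ f g := by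
  rw [l1Dist, l1Dist, ← integral_const_mul]
  simp only [Pi.smul_apply, ← smul_sub, norm_smul, Real.norm_of_nonneg ha]

variable [IsProbabilityMeasure μ]

theorem l1Dist_le_of_forall (h : ∀ x, ‖f x - g x‖ ≤ κ) : l1Dist μ f g ≤ κ := by
  have := norm_integral_le_of_norm_le_const (μ := μ) (f := fun x => ‖f x - g x‖) (C := κ)
    (.of_forall fun x => by simpa using h x)
  exact (Real.le_norm_self _).trans (by simpa [l1Dist] using this)

theorem BddBy.integrable_norm_sub (hf : BddBy M f) (hg : BddBy M' g) :
    Integrable (fun x => ‖f x - g x‖) μ := (hf.sub hg).integrable.norm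

theorem l1Dist_triangle (hf : BddBy M f) (hg : BddBy M' g) (hh : BddBy B h) :
    l1Dist μ f h ≤ l1Dist μ f g + l1Dist μ g h := by
  rw [l1Dist, l1Dist, l1Dist,
    ← integral_add (hf.integrable_norm_sub hg) (hg.integrable_norm_sub hh)]
  exact integral_mono (hf.integrable_norm_sub hh)
    ((hf.integrable_norm_sub hg).add (hg.integrable_norm_sub hh))
    fun x => norm_sub_le_norm_sub_add_norm_sub _ _ _

theorem l1Dist_mul (hM : 0 ≤ M) (hf : BddBy M f) (hf' : BddBy M' f') (hg : BddBy B g)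
    (hg' : BddBy B' g') :
    l1Dist μ (f * f') (g * g') ≤ M * l1Dist μ f' g' + B' * l1Dist μ f g := by
  have hB : 0 ≤ max B 0 := le_max_right _ _
  rw [l1Dist, l1Dist, l1Dist, ← integral_const_mul, ← integral_const_mul,
    ← integral_add ((hf'.integrable_norm_sub hg').const_mul _)
      ((hf.integrable_norm_sub hg).const_mul _)]
  refine integral_mono ((hf.mul hM hf').integrable_norm_sub
    ((hg.mono (le_max_left _ _)).mul hB hg'))
    (((hf'.integrable_norm_sub hg').const_mul _).add
      ((hf.integrable_norm_sub hg).const_mul _)) fun x => ?_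
  have e : (f * f') x - (g * g') x = f x * (f' x - g' x) + g' x * (f x - g x) := by
    simp only [Pi.mul_apply]; ring
  change ‖(f * f') x - (g * g') x‖ ≤ M * ‖f' x - g' x‖ + B' * ‖f x - g x‖
  rw [e]
  refine (norm_add_le _ _).trans ?_
  rw [norm_mul, norm_mul]
  gcongr
  · exact hf.2 x
  · exact hg'.2 x

theorem l1Dist_add (hf : BddBy M f) (hf' : BddBy M' f') (hg : BddBy B g) (hg' : BddBy B' g') :
    l1Dist μ (f + f') (g + g') ≤ l1Dist μ f g + l1Dist μ f' g' := by
  rw [l1Dist, l1Dist, l1Dist,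
    ← integral_add (hf.integrable_norm_sub hg) (hf'.integrable_norm_sub hg')]
  refine integral_mono ((hf.add hf').integrable_norm_sub (hg.add hg'))
    ((hf.integrable_norm_sub hg).add (hf'.integrable_norm_sub hg')) fun x => ?_
  change ‖(f x + f' x) - (g x + g' x)‖ ≤ _
  rw [add_sub_add_comm]
  exact norm_add_le _ _

end L1Dist

end BoundedFunctions

/-! ### Translates and the dual functions of the Gowers seminorms. -/

section Translates

variable {G : Type u} [AddCommGroup G] {X : Type v} [AddAction G X]

theorem actionTranslate_add (g h : G) (f : X → ℂ) :
    actionTranslate (g + h) f = actionTranslate g (actionTranslate h f) := by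
  funext x
  simp [actionTranslate, ← add_vadd, add_comm]

theorem actionTranslate_mul (g : G) (f f' : X → ℂ) :
    actionTranslate g (f * f') = actionTranslate g f * actionTranslate g f' := rfl

theorem actionTranslate_star (g : G) (f : X → ℂ) :
    actionTranslate g (star f) = star (actionTranslate g f) := rfl

theorem gowersDelta_eq (h h' : G) (f : X → ℂ) :
    gowersDelta h h' f = actionTranslate h f * star (actionTranslate h' f) := rfl

theorem gowersDelta_translate (g h h' : G) (f : X → ℂ) :
    gowersDelta h h' (actionTranslate g f) = actionTranslate g (gowersDelta h h' f) := by
  simp only [gowersDelta_eq, ← actionTranslate_add, actionTranslate_mul, actionTranslate_star,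
    add_comm]

/-- By invariance of the measure the outer translate disappears under the integral, so that an
untranslated factor `f` can be split off from every term of the Gowers average. -/
theorem gowersDelta_eq_translate (h h' : G) (f : X → ℂ) :
    gowersDelta h h' f = actionTranslate h (f * star (actionTranslate (h' - h) f)) := by
  simp [gowersDelta_eq, actionTranslate_mul, actionTranslate_star, ← actionTranslate_add]

/-- The cofactor of `f` in the Gowers average: `gowersAvg μ Q d f = ∫ f · gowersCofactor Q d f`. -/
def gowersCofactor (Q : Multiset G) : ℕ → (X → ℂ) → X → ℂ
  | 0, _ => 1
  | d + 1, f => vectorAvg (Q ×ˢ Q) fun p =>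
      star (actionTranslate (p.2 - p.1) f) *
        gowersCofactor Q d (f * star (actionTranslate (p.2 - p.1) f))

theorem gowersCofactor_translate (Q : Multiset G) (d : ℕ) (g : G) (f : X → ℂ) :
    gowersCofactor Q d (actionTranslate g f) = actionTranslate g (gowersCofactor Q d f) := by
  induction d generalizing f with
  | zero => rfl
  | succ d ih =>
    funext x
    simp only [gowersCofactor, actionTranslate]
    rw [vectorAvg_apply, vectorAvg_apply]
    refine vectorAvg_congr fun p _ => ?_
    have e : actionTranslate (p.2 - p.1) (actionTranslate g f) =
        actionTranslate g (actionTranslate (p.2 - p.1) f) := by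
      rw [← actionTranslate_add, ← actionTranslate_add, add_comm]
    have := congrFun (ih (f * star (actionTranslate (p.2 - p.1) f))) x
    change star (actionTranslate (p.2 - p.1) (actionTranslate g f)) x *
      gowersCofactor Q d (actionTranslate g f *
        star (actionTranslate (p.2 - p.1) (actionTranslate g f))) x = _
    rw [e]
    exact congrArg _ this

variable [MeasurableSpace X] {μ : Measure X}

theorem BddBy.translate (hX : IsGSystem G μ) {M : ℝ} {f : X → ℂ} (hf : BddBy M f) (g : G) :
    BddBy M (actionTranslate g f) :=
  ⟨hf.1.comp (hX.measurePreserving (-g)).measurable, fun _ => hf.2 _⟩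

theorem measurableEmbedding_vadd (hX : IsGSystem G μ) (g : G) :
    MeasurableEmbedding (fun x : X => g +ᵥ x) :=
  (MeasurableEquiv.mk (AddAction.toPerm g) (hX.measurePreserving g).measurable
    (hX.measurePreserving (-g)).measurable : X ≃ᵐ X).measurableEmbedding

theorem integral_translate {E : Type*} [NormedAddCommGroup E] [NormedSpace ℝ E]
    (hX : IsGSystem G μ) (g : G) (F : X → E) :
    ∫ x, F (-g +ᵥ x) ∂μ = ∫ x, F x ∂μ :=
  (hX.measurePreserving (-g)).integral_comp (measurableEmbedding_vadd hX (-g)) F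

theorem l1Dist_translate (hX : IsGSystem G μ) (g : G) (f f' : X → ℂ) :
    l1Dist μ (actionTranslate g f) (actionTranslate g f') = l1Dist μ f f' :=
  integral_translate hX g fun x => ‖f x - f' x‖

theorem gowersAvg_translate (hX : IsGSystem G μ) (Q : Multiset G) (d : ℕ) (g : G) (f : X → ℂ) :
    gowersAvg μ Q d (actionTranslate g f) = gowersAvg μ Q d f := by
  induction d generalizing f with
  | zero => exact integral_translate hX g f
  | succ d ih => simp only [gowersAvg, gowersDelta_translate, ih]

theorem gowersAvg_succ (Q : Multiset G) (d : ℕ) (f : X → ℂ) :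
    gowersAvg μ Q (d + 1) f =
      vectorAvg (Q ×ˢ Q) fun p => gowersAvg μ Q d (gowersDelta p.1 p.2 f) :=
  multisetAvg_eq_vectorAvg _ _

theorem BddBy.gowersDelta (hX : IsGSystem G μ) {f : X → ℂ} (hf : BddBy 1 f) (h h' : G) :
    BddBy 1 (gowersDelta h h' f) := by
  simpa [gowersDelta_eq] using (hf.translate hX h).mul zero_le_one (hf.translate hX h').star

theorem BddBy.vectorAvg {α : Type*} {M : ℝ} (hM : 0 ≤ M) (A : Multiset α) {F : α → X → ℂ}
    (hF : ∀ a ∈ A, BddBy M (F a)) : BddBy M (vectorAvg A F) := by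
  rcases eq_or_ne A 0 with rfl | hA
  · simp only [_root_.vectorAvg, Multiset.map_zero, Multiset.sum_zero, smul_zero]
    exact BddBy.const 0 (by simpa using hM)
  · exact vectorAvg_mem (BddBy.convex M) hA hF

theorem BddBy.gowersCofactor (hX : IsGSystem G μ) {f : X → ℂ} (hf : BddBy 1 f) (Q : Multiset G)
    (d : ℕ) : BddBy 1 (gowersCofactor Q d f) := by
  induction d generalizing f with
  | zero => exact BddBy.const 1 (by simp)
  | succ d ih =>
    refine BddBy.vectorAvg zero_le_one _ fun p _ => ?_
    have h := (hf.translate hX (p.2 - p.1)).star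
    simpa using h.mul zero_le_one (ih (by simpa using hf.mul zero_le_one h))

/-- Induction on `d`: each derivative may be replaced by `f * star (T^{h'-h} f)`, whose first factor
`f` is common to all terms. -/
theorem integral_mul_gowersCofactor (hX : IsGSystem G μ) {f : X → ℂ} (hf : BddBy 1 f)
    (Q : Multiset G) (d : ℕ) : ∫ x, f x * gowersCofactor Q d f x ∂μ = gowersAvg μ Q d f := by
  have := hX.isProbabilityMeasure
  induction d generalizing f with
  | zero => simp [gowersCofactor, gowersAvg]
  | succ d ih =>
    have hb : ∀ p : G × G, BddBy 1 (f * star (actionTranslate (p.2 - p.1) f)) := fun p => by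
      simpa using hf.mul zero_le_one (hf.translate hX (p.2 - p.1)).star
    rw [gowersAvg_succ]
    simp only [gowersDelta_eq_translate, gowersAvg_translate hX, ← ih (hb _)]
    rw [← integral_vectorAvg (F := fun (p : G × G) x =>
      (f * star (actionTranslate (p.2 - p.1) f)) x *
        gowersCofactor Q d (f * star (actionTranslate (p.2 - p.1) f)) x) _ fun p =>
      ((hb p).mul zero_le_one ((hb p).gowersCofactor hX Q d)).integrable]
    refine integral_congr_ae (.of_forall fun x => ?_)
    simp only [gowersCofactor]
    rw [vectorAvg_apply, mul_vectorAvg]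
    simp only [Pi.mul_apply, mul_assoc]

end Translates

/-! ### Classes of functions over a collection of systems, and their closure properties. -/

set_option linter.checkUnivs false in
/-- A bundled `G`-system. -/
structure SystemData where
  G : Type u
  [group : AddCommGroup G]
  X : Type v
  [measurableSpace : MeasurableSpace X]
  [action : AddAction G X]
  μ : Measure X
  isGSystem : IsGSystem G μ

attribute [instance] SystemData.group SystemData.measurableSpace SystemData.action

instance (s : SystemData.{u, v}) : IsProbabilityMeasure s.μ := s.isGSystem.isProbabilityMeasure

variable {I : Type w}

/-- A set of functions on each system of a given collection of systems. -/
abbrev FunctionClass (S : I → SystemData.{u, v}) := ∀ i, Set ((S i).X → ℂ)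

variable {S : I → SystemData.{u, v}}

/-- The functions of the class are measurable and bounded by one common constant. -/
def UniformlyBdd (F : FunctionClass S) : Prop := ∃ M, 0 ≤ M ∧ ∀ i, ∀ f ∈ F i, BddBy M f

/-- The constant functions bounded by `M`. -/
def constClass (S : I → SystemData.{u, v}) (M : ℝ) : FunctionClass S :=
  fun _ => {f | ∃ c : ℂ, ‖c‖ ≤ M ∧ f = fun _ => c}

/-- The class with the constant function `1` only. -/
def oneClass (S : I → SystemData.{u, v}) : FunctionClass S := fun _ => {1}

/-- All translates of the functions of a class. -/
def translates (F : FunctionClass S) : FunctionClass S :=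
  fun i => {f | ∃ g : (S i).G, ∃ f' ∈ F i, f = actionTranslate g f'}

/-- The finite convex combinations of the functions of a class. -/
def hull (F : FunctionClass S) : FunctionClass S := fun i => convexHull ℝ (F i)

/-- The complex conjugates of the functions of a class. -/
def conjClass (F : FunctionClass S) : FunctionClass S := fun i => (fun f => star f) '' F i

def mulClass (F F' : FunctionClass S) : FunctionClass S := fun i => F i * F' i

def addClass (F F' : FunctionClass S) : FunctionClass S := fun i => F i + F' i

/-- A collection of uniformly bounded classes that is closed under products and conjugation. -/
structure IsMultiplicative (Z : FunctionClass S → Prop) : Prop where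
  bdd : ∀ {F}, Z F → UniformlyBdd F
  mono : ∀ {F F'}, F ≤ F' → Z F' → Z F
  sup : ∀ {F F'}, Z F → Z F' → Z (F ⊔ F')
  mul : ∀ {F F'}, Z F → Z F' → Z (mulClass F F')
  star : ∀ {F}, Z F → Z (conjClass F)
  one : Z (oneClass S)

/-- A collection of classes that is closed under the algebra operations and uniform limits
in `L¹`. -/
structure IsAlgCollection (Z : FunctionClass S → Prop) : Prop extends IsMultiplicative Z where
  add : ∀ {F F'}, Z F → Z F' → Z (addClass F F')
  const : ∀ M, Z (constClass S M)
  lim : ∀ {F}, UniformlyBdd F →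
    (∀ κ : ℝ, 0 < κ → ∃ F', Z F' ∧ ∀ i, ∀ f ∈ F i, ∃ f' ∈ F' i,
      l1Dist (S i).μ f f' ≤ κ) → Z F

/-- An algebraic collection that is also closed under translations and convex combinations. -/
structure IsInvariantAlg (Z : FunctionClass S → Prop) : Prop extends IsAlgCollection Z where
  translates : ∀ {F}, Z F → Z (translates F)
  hull : ∀ {F}, Z F → Z (hull F)

theorem IsMultiplicative.inter {Z Z' : FunctionClass S → Prop} (h : IsMultiplicative Z)
    (h' : IsMultiplicative Z') : IsMultiplicative fun F => Z F ∧ Z' F where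
  bdd := fun hF => h.bdd hF.1
  mono := fun hle hF => ⟨h.mono hle hF.1, h'.mono hle hF.2⟩
  sup := fun h1 h2 => ⟨h.sup h1.1 h2.1, h'.sup h1.2 h2.2⟩
  mul := fun h1 h2 => ⟨h.mul h1.1 h2.1, h'.mul h1.2 h2.2⟩
  star := fun h1 => ⟨h.star h1.1, h'.star h1.2⟩
  one := ⟨h.one, h'.one⟩

theorem IsInvariantAlg.inter {Z Z' : FunctionClass S → Prop} (h : IsInvariantAlg Z)
    (h' : IsInvariantAlg Z') : IsInvariantAlg fun F => Z F ∧ Z' F where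
  __ := h.toIsMultiplicative.inter h'.toIsMultiplicative
  add := fun h1 h2 => ⟨h.add h1.1 h2.1, h'.add h1.2 h2.2⟩
  const := fun M => ⟨h.const M, h'.const M⟩
  lim := fun hb hl =>
    ⟨h.lim hb fun κ hκ => (hl κ hκ).imp fun _ hF => ⟨hF.1.1, hF.2⟩,
      h'.lim hb fun κ hκ => (hl κ hκ).imp fun _ hF => ⟨hF.1.2, hF.2⟩⟩
  translates := fun h1 => ⟨h.translates h1.1, h'.translates h1.2⟩
  hull := fun h1 => ⟨h.hull h1.1, h'.hull h1.2⟩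

theorem isMultiplicative_uniformlyBdd : IsMultiplicative (UniformlyBdd (S := S)) where
  bdd := id
  mono := fun h ⟨M, hM, hF⟩ => ⟨M, hM, fun i f hf => hF i f (h i hf)⟩
  sup := fun ⟨M, hM, hF⟩ ⟨M', hM', hF'⟩ => by
    refine ⟨max M M', le_max_of_le_left hM, fun i f hf => ?_⟩
    rcases hf with hf | hf
    · exact (hF i f hf).mono (le_max_left _ _)
    · exact (hF' i f hf).mono (le_max_right _ _)
  mul := fun ⟨M, hM, hF⟩ ⟨M', hM', hF'⟩ => by
    refine ⟨M * M', mul_nonneg hM hM', ?_⟩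
    rintro i _ ⟨f, hf, f', hf', rfl⟩
    exact (hF i f hf).mul hM (hF' i f' hf')
  star := fun ⟨M, hM, hF⟩ => by
    refine ⟨M, hM, ?_⟩
    rintro i _ ⟨f, hf, rfl⟩
    exact (hF i f hf).star
  one := ⟨1, zero_le_one, by rintro i _ rfl; exact BddBy.const 1 (by simp)⟩

theorem isInvariantAlg_uniformlyBdd : IsInvariantAlg (UniformlyBdd (S := S)) where
  __ := isMultiplicative_uniformlyBdd
  add := fun ⟨M, hM, hF⟩ ⟨M', hM', hF'⟩ => by
    refine ⟨M + M', add_nonneg hM hM', ?_⟩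
    rintro i _ ⟨f, hf, f', hf', rfl⟩
    exact (hF i f hf).add (hF' i f' hf')
  const := fun M => by
    refine ⟨max M 0, le_max_right _ _, ?_⟩
    rintro i _ ⟨c, hc, rfl⟩
    exact BddBy.const c (hc.trans (le_max_left _ _))
  lim := fun hb _ => hb
  translates := fun ⟨M, hM, hF⟩ => by
    refine ⟨M, hM, ?_⟩
    rintro i _ ⟨g, f, hf, rfl⟩
    exact (hF i f hf).translate (S i).isGSystem g
  hull := fun ⟨M, hM, hF⟩ =>
    ⟨M, hM, fun i _ hf => convexHull_min (fun f hf => hF i f hf) (BddBy.convex M) hf⟩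

namespace IsAlgCollection

variable {Z : FunctionClass S → Prop}

theorem smul (h : IsAlgCollection Z) {F : FunctionClass S} (hF : Z F) (c : ℂ) :
    Z fun i => (fun f => (fun _ => c) * f) '' F i := by
  refine h.mono ?_ (h.mul (h.const ‖c‖) hF)
  rintro i _ ⟨f, hf, rfl⟩
  exact ⟨_, ⟨c, le_rfl, rfl⟩, f, hf, rfl⟩

theorem sub (h : IsAlgCollection Z) {F F' : FunctionClass S} (hF : Z F) (hF' : Z F') :
    Z fun i => F i - F' i := by
  refine h.mono ?_ (h.add hF (h.smul hF' (-1)))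
  rintro i _ ⟨f, hf, f', hf', rfl⟩
  refine ⟨f, hf, _, ⟨f', hf', rfl⟩, ?_⟩
  funext x
  simp [sub_eq_add_neg]

/-- By the Stone–Weierstrass theorem, an algebraic collection is closed under composition with
continuous functions. -/
theorem comp_continuous (h : IsAlgCollection Z) {F : FunctionClass S} (hF : Z F) {ψ : ℂ → ℂ}
    (hψ : Continuous ψ) : Z fun i => (fun f x => ψ (f x)) '' F i := by
  obtain ⟨M, hM, hb⟩ := h.bdd hF
  let K : Set ℂ := Metric.closedBall 0 M
  have hK : CompactSpace K := isCompact_iff_compactSpace.1 (isCompact_closedBall 0 M)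
  have hmem : ∀ {i} {f : (S i).X → ℂ}, f ∈ F i → ∀ x, f x ∈ K := fun {i f} hf x => by
    simpa [K] using (hb i f hf).2 x
  let comp : C(K, ℂ) → FunctionClass S :=
    fun p i => {g | ∃ f, ∃ hf : f ∈ F i, g = fun x => p ⟨f x, hmem hf x⟩}
  suffices key : ∀ p, Z (comp p) by
    refine h.mono ?_ (key ⟨fun z => ψ z, hψ.comp continuous_subtype_val⟩)
    rintro i _ ⟨f, hf, rfl⟩
    exact ⟨f, hf, rfl⟩
  intro p
  refine p.induction_on ?_ ?_ ?_ ?_ ?_ ?_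
  · intro c
    refine h.mono ?_ (h.const ‖c‖)
    rintro i _ ⟨f, hf, rfl⟩
    exact ⟨c, le_rfl, rfl⟩
  · refine h.mono ?_ hF
    rintro i _ ⟨f, hf, rfl⟩
    exact hf
  · refine h.mono ?_ (h.star hF)
    rintro i _ ⟨f, hf, rfl⟩
    exact ⟨f, hf, rfl⟩
  · intro p q hp hq
    refine h.mono ?_ (h.add hp hq)
    rintro i _ ⟨f, hf, rfl⟩
    exact ⟨_, ⟨f, hf, rfl⟩, _, ⟨f, hf, rfl⟩, rfl⟩
  · intro p q hp hq
    refine h.mono ?_ (h.mul hp hq)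
    rintro i _ ⟨f, hf, rfl⟩
    exact ⟨_, ⟨f, hf, rfl⟩, _, ⟨f, hf, rfl⟩, rfl⟩
  · intro key p
    refine h.lim ⟨‖p‖, norm_nonneg _, ?_⟩ fun κ hκ => ?_
    · rintro i _ ⟨f, hf, rfl⟩
      exact ⟨p.continuous.measurable.comp ((hb i f hf).1.subtype_mk),
        fun x => p.norm_coe_le_norm ⟨f x, hmem hf x⟩⟩
    · have hd : p ∈ (polynomialFunctions K).starClosure.topologicalClosure := by
        rw [polynomialFunctions.starClosure_topologicalClosure]
        trivial
      obtain ⟨q, hq, hpq⟩ := Metric.mem_closure_iff.1 hd κ hκ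
      refine ⟨comp q, key q hq, ?_⟩
      rintro i _ ⟨f, hf, rfl⟩
      refine ⟨_, ⟨f, hf, rfl⟩, ?_⟩
      refine l1Dist_le_of_forall fun x => ?_
      have := (p - q).norm_coe_le_norm ⟨f x, hmem hf x⟩
      rw [dist_eq_norm] at hpq
      exact this.trans hpq.le

end IsAlgCollection

/-! ### Anti-uniform and almost periodic classes. -/

theorem mul_mem_convexHull_mul {A : Type*} [CommRing A] [Algebra ℝ A] {s t : Set A} {x y : A}
    (hx : x ∈ convexHull ℝ s) (hy : y ∈ convexHull ℝ t) : x * y ∈ convexHull ℝ (s * t) := by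
  have h1 : s ⊆ (LinearMap.mulRight ℝ y) ⁻¹' convexHull ℝ (s * t) := fun a ha => by
    have h2 : t ⊆ (LinearMap.mulLeft ℝ a) ⁻¹' convexHull ℝ (s * t) := fun b hb =>
      subset_convexHull ℝ _ (Set.mul_mem_mul ha hb)
    exact convexHull_min h2 ((convex_convexHull ℝ _).linear_preimage _) hy
  exact convexHull_min h1 ((convex_convexHull ℝ _).linear_preimage _) hx

theorem map_mem_convexHull {V W : Type*} [AddCommGroup V] [Module ℝ V] [AddCommGroup W]
    [Module ℝ W] {s : Set V} {t : Set W} (L : V →ₗ[ℝ] W) (h : ∀ x ∈ s, L x ∈ t) {x : V}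
    (hx : x ∈ convexHull ℝ s) : L x ∈ convexHull ℝ t := by
  have h1 : s ⊆ L ⁻¹' convexHull ℝ t := fun a ha => subset_convexHull ℝ _ (h a ha)
  exact convexHull_min h1 ((convex_convexHull ℝ _).linear_preimage L) hx

/-- A family of averaging multisets `Q i ε` at each scale `ε`, such that averages at a scale `ε`
are almost invariant under shifts at all sufficiently small scales, uniformly in `i`. -/
structure ScaleFamily (S : I → SystemData.{u, v}) where
  Q : ∀ i, ℝ → Multiset (S i).G
  ne_zero : ∀ i ε, Q i ε ≠ 0
  shift : ∀ ε : ℝ, 0 < ε → ∀ κ : ℝ, 0 < κ → ∃ η : ℝ, 0 < η ∧ ∀ η' : ℝ, 0 < η' → η' ≤ η →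
    ∀ i, ∀ n ∈ Q i η', ∀ φ : (S i).G → ℂ, (∀ g, ‖φ g‖ ≤ 1) →
      ‖vectorAvg (Q i ε) (fun h => φ (h + n)) - vectorAvg (Q i ε) φ‖ ≤ κ

/-- Uniform anti-uniformity of order `d` of a class of functions, in the direction `P`. -/
def AntiUniform (P : ScaleFamily S) : ℕ → FunctionClass S → Prop
  | 0, F => F ≤ oneClass S
  | d + 1, F => UniformlyBdd F ∧ ∀ δ : ℝ, 0 < δ → ∃ ε₀ : ℝ, 0 < ε₀ ∧
      ∀ ε : ℝ, 0 < ε → ε ≤ ε₀ → ∀ i, ∀ f ∈ F i, ∀ g, BddBy 1 g →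
        ‖gowersAvg (S i).μ (P.Q i ε) (d + 1) g‖ ≤ ε ^ 2 ^ (d + 1) →
          ‖∫ x, f x * conj (g x) ∂(S i).μ‖ ≤ δ

/-- Order 0 is closed under products and conjugation but not under sums. Coefficient collections are
therefore only ever required to be `IsMultiplicative`. -/
theorem isMultiplicative_antiUniform_zero (P : ScaleFamily S) :
    IsMultiplicative (AntiUniform P 0) where
  bdd := fun hF => isMultiplicative_uniformlyBdd.mono hF isMultiplicative_uniformlyBdd.one
  mono := fun h hF => h.trans hF
  sup := fun h h' => sup_le h h'
  mul := fun h h' => by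
    rintro i _ ⟨f, hf, f', hf', rfl⟩
    obtain rfl := h i hf
    obtain rfl := h' i hf'
    exact mul_one _
  star := fun h => by
    rintro i _ ⟨f, hf, rfl⟩
    obtain rfl := h i hf
    exact star_one _
  one := le_rfl

/-- The families `n ↦ c n * h` with `c n ∈ C` and `h ∈ H`. -/
def modulated (G : Type u) {X : Type v} (C H : Set (X → ℂ)) : Set (G → X → ℂ) :=
  {v | ∃ c : G → X → ℂ, (∀ n, c n ∈ C) ∧ ∃ h ∈ H, v = fun n => c n * h}

theorem modulated_mono {G : Type u} {X : Type v} {C C' H H' : Set (X → ℂ)} (hC : C ⊆ C')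
    (hH : H ⊆ H') : modulated G C H ⊆ modulated G C' H' := by
  rintro _ ⟨c, hc, h, hh, rfl⟩
  exact ⟨c, fun n => hC (hc n), h, hH hh, rfl⟩

theorem bddBy_of_mem_hull_modulated {G : Type u} {X : Type v} [MeasurableSpace X]
    {C H : Set (X → ℂ)} {M B : ℝ} (hM : 0 ≤ M) (hC : ∀ c ∈ C, BddBy M c)
    (hH : ∀ h ∈ H, BddBy B h) {v : G → X → ℂ} (hv : v ∈ convexHull ℝ (modulated G C H)) (n : G) :
    BddBy (M * B) (v n) := by
  have h1 : modulated G C H ⊆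
      (LinearMap.proj n : (G → X → ℂ) →ₗ[ℝ] _) ⁻¹' {f | BddBy (M * B) f} := by
    rintro _ ⟨c, hc, h, hh, rfl⟩
    exact (hC _ (hc n)).mul hM (hH _ hh)
  exact convexHull_min h1 ((BddBy.convex _).linear_preimage _) hv

/-- Classes in `Y` whose translates along small scales of `P` are approximated by averages
of products `c n * h`, where `c` runs through a class in `Z` and `h` through a class in `Y`. -/
def AlmostPeriodic (P : ScaleFamily S) (Z Y : FunctionClass S → Prop) (F : FunctionClass S) :
    Prop :=
  Y F ∧ ∀ κ : ℝ, 0 < κ → ∃ η : ℝ, 0 < η ∧ ∃ C, Z C ∧ ∃ H, Y H ∧ ∀ i, ∀ f ∈ F i,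
    ∃ v ∈ convexHull ℝ (modulated (S i).G (C i) (H i)), ∀ η' : ℝ, 0 < η' → η' ≤ η →
      ∀ n ∈ P.Q i η', l1Dist (S i).μ (actionTranslate n f) (v n) ≤ κ

/-- Families `c n * h` multiply termwise, and products of convex hulls lie in the hull of the
products. Additive closure rests on `Y` alone, because `Z` need not be closed under sums. -/
theorem isAlgCollection_almostPeriodic (P : ScaleFamily S) {Z Y : FunctionClass S → Prop}
    (hZ : IsMultiplicative Z) (hY : IsAlgCollection Y) :
    IsAlgCollection (AlmostPeriodic P Z Y) where
  bdd := fun hF => hY.bdd hF.1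
  mono := fun {F F'} hle hF => by
    refine ⟨hY.mono hle hF.1, fun κ hκ => ?_⟩
    obtain ⟨η, hη, C, hC, H, hH, h⟩ := hF.2 κ hκ
    exact ⟨η, hη, C, hC, H, hH, fun i f hf => h i f (hle i hf)⟩
  sup := fun {F F'} hF hF' => by
    refine ⟨hY.sup hF.1 hF'.1, fun κ hκ => ?_⟩
    obtain ⟨η, hη, C, hC, H, hH, h⟩ := hF.2 κ hκ
    obtain ⟨η', hη', C', hC', H', hH', h'⟩ := hF'.2 κ hκ
    refine ⟨min η η', lt_min hη hη', _, hZ.sup hC hC', _, hY.sup hH hH', fun i f hf => ?_⟩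
    rcases hf with hf | hf
    · obtain ⟨v, hv, hd⟩ := h i f hf
      exact ⟨v, convexHull_mono (modulated_mono le_sup_left le_sup_left) hv,
        fun ζ h0 hζ => hd ζ h0 (hζ.trans (min_le_left _ _))⟩
    · obtain ⟨v, hv, hd⟩ := h' i f hf
      exact ⟨v, convexHull_mono (modulated_mono le_sup_right le_sup_right) hv,
        fun ζ h0 hζ => hd ζ h0 (hζ.trans (min_le_right _ _))⟩
  mul := fun {F F'} hF hF' => by
    refine ⟨hY.mul hF.1 hF'.1, fun κ hκ => ?_⟩
    obtain ⟨M, hM, hFb⟩ := hY.bdd hF.1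
    obtain ⟨M', hM', hFb'⟩ := hY.bdd hF'.1
    -- The second factor is approximated first: the tolerance for the first factor depends on the
    -- bound `A' * B'` of this approximation.
    obtain ⟨η', hη', C', hC', H', hH', h'⟩ := hF'.2 (κ / (2 * (M + 1))) (by positivity)
    obtain ⟨A', hA', hCb'⟩ := hZ.bdd hC'
    obtain ⟨B', hB', hHb'⟩ := hY.bdd hH'
    obtain ⟨η, hη, C, hC, H, hH, h⟩ := hF.2 (κ / (2 * (A' * B' + 1))) (by positivity)
    obtain ⟨A, hA, hCb⟩ := hZ.bdd hC
    obtain ⟨B, hB, hHb⟩ := hY.bdd hH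
    refine ⟨min η η', lt_min hη hη', _, hZ.mul hC hC', _, hY.mul hH hH', ?_⟩
    rintro i _ ⟨f, hf, f', hf', rfl⟩
    obtain ⟨v, hv, hd⟩ := h i f hf
    obtain ⟨v', hv', hd'⟩ := h' i f' hf'
    refine ⟨v * v', convexHull_mono ?_ (mul_mem_convexHull_mul hv hv'), fun ζ h0 hζ n hn => ?_⟩
    · rintro _ ⟨_, ⟨c, hc, k, hk, rfl⟩, _, ⟨c', hc', k', hk', rfl⟩, rfl⟩
      refine ⟨c * c', fun n => ⟨_, hc n, _, hc' n, rfl⟩, _, ⟨k, hk, k', hk', rfl⟩, ?_⟩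
      funext n
      exact mul_mul_mul_comm _ _ _ _
    · have e1 := hd ζ h0 (hζ.trans (min_le_left _ _)) n hn
      have e2 := hd' ζ h0 (hζ.trans (min_le_right _ _)) n hn
      have hX := (S i).isGSystem
      refine (l1Dist_mul hM ((hFb i f hf).translate hX n) ((hFb' i f' hf').translate hX n)
        (bddBy_of_mem_hull_modulated hA (hCb i) (hHb i) hv n)
        (bddBy_of_mem_hull_modulated hA' (hCb' i) (hHb' i) hv' n)).trans ?_
      have a1 : M * (κ / (2 * (M + 1))) ≤ κ / 2 := by
        rw [mul_div_assoc', div_le_div_iff₀ (by positivity) (by positivity)]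
        nlinarith
      have a2 : A' * B' * (κ / (2 * (A' * B' + 1))) ≤ κ / 2 := by
        have := mul_nonneg hA' hB'
        rw [mul_div_assoc', div_le_div_iff₀ (by positivity) (by positivity)]
        nlinarith
      have a3 := mul_le_mul_of_nonneg_left e1 (mul_nonneg hA' hB')
      have a4 := mul_le_mul_of_nonneg_left e2 hM
      linarith
  star := fun {F} hF => by
    refine ⟨hY.star hF.1, fun κ hκ => ?_⟩
    obtain ⟨η, hη, C, hC, H, hH, h⟩ := hF.2 κ hκ
    refine ⟨η, hη, _, hZ.star hC, _, hY.star hH, ?_⟩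
    rintro i _ ⟨f, hf, rfl⟩
    obtain ⟨v, hv, hd⟩ := h i f hf
    let L : ((S i).G → (S i).X → ℂ) →ₗ[ℝ] ((S i).G → (S i).X → ℂ) :=
      { toFun := star, map_add' := star_add, map_smul' := fun a v => by simp }
    refine ⟨L v, map_mem_convexHull L ?_ hv, fun ζ h0 hζ n hn => ?_⟩
    · rintro _ ⟨c, hc, k, hk, rfl⟩
      refine ⟨star c, fun n => ⟨_, hc n, rfl⟩, _, ⟨k, hk, rfl⟩, ?_⟩
      funext n
      simp [L]
    · exact l1Dist_star.trans_le (hd ζ h0 hζ n hn)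
  one := by
    refine ⟨hY.one, fun κ hκ => ⟨1, one_pos, _, hZ.one, _, hY.one, ?_⟩⟩
    rintro i _ rfl
    refine ⟨_, subset_convexHull ℝ _ ⟨fun _ => 1, fun _ => rfl, 1, rfl, rfl⟩,
      fun ζ h0 hζ n hn => ?_⟩
    rw [mul_one]
    exact l1Dist_self.trans_le hκ.le
  add := fun {F F'} hF hF' => by
    refine ⟨hY.add hF.1 hF'.1, fun κ hκ => ?_⟩
    obtain ⟨M, hM, hFb⟩ := hY.bdd hF.1
    obtain ⟨M', hM', hFb'⟩ := hY.bdd hF'.1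
    obtain ⟨η, hη, C, hC, H, hH, h⟩ := hF.2 (κ / 2) (by positivity)
    obtain ⟨η', hη', C', hC', H', hH', h'⟩ := hF'.2 (κ / 2) (by positivity)
    obtain ⟨A', hA', hCb'⟩ := hZ.bdd hC'
    obtain ⟨B', hB', hHb'⟩ := hY.bdd hH'
    obtain ⟨A, hA, hCb⟩ := hZ.bdd hC
    obtain ⟨B, hB, hHb⟩ := hY.bdd hH
    -- Coefficient classes are united, not added. The sum `v + v'` is the midpoint of `2 v` and `2
    -- v'`, and the factor 2 is absorbed into `h`.
    refine ⟨min η η', lt_min hη hη', _, hZ.sup hC hC', _,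
      hY.sup (hY.smul hH 2) (hY.smul hH' 2), ?_⟩
    rintro i _ ⟨f, hf, f', hf', rfl⟩
    obtain ⟨v, hv, hd⟩ := h i f hf
    obtain ⟨v', hv', hd'⟩ := h' i f' hf'
    refine ⟨v + v', ?_, fun ζ h0 hζ n hn => ?_⟩
    · let L : ((S i).G → (S i).X → ℂ) →ₗ[ℝ] ((S i).G → (S i).X → ℂ) := (2 : ℝ) • LinearMap.id
      have e : v + v' = (1 / 2 : ℝ) • L v + (1 / 2 : ℝ) • L v' := by
        simp [L, smul_smul]
      rw [e]
      refine convex_convexHull ℝ _ (map_mem_convexHull L ?_ hv) (map_mem_convexHull L ?_ hv')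
        (by norm_num) (by norm_num) (by norm_num)
      · rintro _ ⟨c, hc, k, hk, rfl⟩
        refine ⟨c, fun n => Or.inl (hc n), _, Or.inl ⟨k, hk, rfl⟩, ?_⟩
        funext n x
        simp [L]
        ring
      · rintro _ ⟨c, hc, k, hk, rfl⟩
        refine ⟨c, fun n => Or.inr (hc n), _, Or.inr ⟨k, hk, rfl⟩, ?_⟩
        funext n x
        simp [L]
        ring
    · have e1 := hd ζ h0 (hζ.trans (min_le_left _ _)) n hn
      have e2 := hd' ζ h0 (hζ.trans (min_le_right _ _)) n hn
      have hX := (S i).isGSystem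
      refine (l1Dist_add ((hFb i f hf).translate hX n) ((hFb' i f' hf').translate hX n)
        (bddBy_of_mem_hull_modulated hA (hCb i) (hHb i) hv n)
        (bddBy_of_mem_hull_modulated hA' (hCb' i) (hHb' i) hv' n)).trans ?_
      linarith
  const := fun M => by
    refine ⟨hY.const M, fun κ hκ => ⟨1, one_pos, _, hZ.one, _, hY.const M, ?_⟩⟩
    rintro i _ ⟨c, hc, rfl⟩
    refine ⟨_, subset_convexHull ℝ _ ⟨fun _ => 1, fun _ => rfl, _, ⟨c, hc, rfl⟩, rfl⟩,
      fun ζ h0 hζ n hn => ?_⟩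
    rw [one_mul]
    exact l1Dist_self.trans_le hκ.le
  lim := fun {F} hb hl => by
    refine ⟨hY.lim hb fun κ hκ => (hl κ hκ).imp fun _ hF => ⟨hF.1.1, hF.2⟩, fun κ hκ => ?_⟩
    obtain ⟨F', hF', hFF'⟩ := hl (κ / 2) (by positivity)
    obtain ⟨M, hM, hFb⟩ := hb
    obtain ⟨M', hM', hFb'⟩ := hY.bdd hF'.1
    obtain ⟨η, hη, C, hC, H, hH, h⟩ := hF'.2 (κ / 2) (by positivity)
    obtain ⟨A, hA, hCb⟩ := hZ.bdd hC
    obtain ⟨B, hB, hHb⟩ := hY.bdd hH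
    refine ⟨η, hη, C, hC, H, hH, fun i f hf => ?_⟩
    obtain ⟨f', hf', hff'⟩ := hFF' i f hf
    obtain ⟨v, hv, hd⟩ := h i f' hf'
    refine ⟨v, hv, fun ζ h0 hζ n hn => ?_⟩
    have hX := (S i).isGSystem
    refine (l1Dist_triangle ((hFb i f hf).translate hX n) ((hFb' i f' hf').translate hX n)
      (bddBy_of_mem_hull_modulated hA (hCb i) (hHb i) hv n)).trans ?_
    rw [l1Dist_translate hX]
    have := hd ζ h0 hζ n hn
    linarith

/-! ### From almost periodicity to anti-uniformity by Cauchy–Schwarz. -/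

theorem sq_integral_norm_le {X : Type v} [MeasurableSpace X] {μ : Measure X}
    [IsProbabilityMeasure μ] {M : ℝ} {f : X → ℂ} (hf : BddBy M f) :
    (∫ x, ‖f x‖ ∂μ) ^ 2 ≤ ∫ x, ‖f x‖ ^ 2 ∂μ := by
  set m := ∫ x, ‖f x‖ ∂μ
  have h1 : Integrable (fun x => ‖f x‖) μ := hf.integrable.norm
  have h2 : Integrable (fun x => ‖f x‖ ^ 2) μ := by
    refine Integrable.of_bound (hf.1.norm.pow_const 2).aestronglyMeasurable (M ^ 2)
      (.of_forall fun x => ?_)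
    rw [Real.norm_of_nonneg (by positivity)]
    exact pow_le_pow_left₀ (norm_nonneg _) (hf.2 x) 2
  have h3 : 0 ≤ ∫ x, (‖f x‖ - m) ^ 2 ∂μ := integral_nonneg fun x => sq_nonneg _
  have h4 : ∫ x, (‖f x‖ - m) ^ 2 ∂μ = ∫ x, ‖f x‖ ^ 2 ∂μ - m ^ 2 := by
    have e : ∀ x, (‖f x‖ - m) ^ 2 = ‖f x‖ ^ 2 - (2 * m) * ‖f x‖ + m ^ 2 := fun x => by ring
    simp only [e]
    rw [integral_add (f := fun x => ‖f x‖ ^ 2 - (2 * m) * ‖f x‖) (h2.sub (h1.const_mul _))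
      (integrable_const _), integral_sub h2 (h1.const_mul _), integral_const_mul]
    simp only [integral_const, probReal_univ, one_smul]
    change _ - 2 * m * m + m ^ 2 = _
    ring
  linarith

theorem norm_integral_mul_le {X : Type v} [MeasurableSpace X] {μ : Measure X}
    [IsProbabilityMeasure μ] {B M : ℝ} {f g : X → ℂ} (hf : BddBy B f)
    (hg : BddBy M g) : ‖∫ x, f x * g x ∂μ‖ ≤ B * ∫ x, ‖g x‖ ∂μ := by
  rw [← integral_const_mul]
  refine norm_integral_le_of_norm_le (hg.integrable.norm.const_mul B) (.of_forall fun x => ?_)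
  rw [norm_mul]
  exact mul_le_mul_of_nonneg_right (hf.2 x) (norm_nonneg _)

theorem integral_norm_sq_vectorAvg {X : Type v} [MeasurableSpace X] {μ : Measure X}
    [IsProbabilityMeasure μ] {A : ℝ} (hA : 0 ≤ A)
    {G : Type*} (Q : Multiset G) {a : G → X → ℂ} (ha : ∀ n, BddBy A (a n)) :
    ((∫ x, ‖vectorAvg Q (fun n => a n x)‖ ^ 2 ∂μ : ℝ) : ℂ) =
      vectorAvg (Q ×ˢ Q) fun p => ∫ x, a p.1 x * conj (a p.2 x) ∂μ := by
  rw [← integral_complex_ofReal, ← integral_vectorAvg (F := fun (p : G × G) x =>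
    a p.1 x * conj (a p.2 x)) _ fun p => ((ha p.1).mul hA (ha p.2).star).integrable]
  refine integral_congr_ae (.of_forall fun x => ?_)
  change ((‖vectorAvg Q (fun n => a n x)‖ ^ 2 : ℝ) : ℂ) = _
  rw [← Complex.normSq_eq_norm_sq, ← Complex.mul_conj]
  simp only [vectorAvg_product, conj_vectorAvg, ← mul_vectorAvg]
  rw [mul_comm, mul_vectorAvg]
  simp only [mul_comm]

section CauchySchwarz

variable {G : Type u} [AddCommGroup G] {X : Type v} [MeasurableSpace X] [AddAction G X]
  {μ : Measure X}

/-- The factor `h` does not depend on `n`, so it comes out of the average and is bounded by `B`.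
Expanding the square of what remains produces the pairs `c n * star (c n')` and the derivatives of
`g`. -/
theorem sq_norm_correlation_le (hX : IsGSystem G μ) (Q : Multiset G) {A B : ℝ} (hA : 0 ≤ A)
    {c : G → X → ℂ} (hc : ∀ n, BddBy A (c n)) {h g : X → ℂ} (hB : 0 ≤ B) (hh : BddBy B h)
    (hg : BddBy 1 g) :
    ‖vectorAvg Q fun n => ∫ x, (c n * h) x * conj (actionTranslate n g x) ∂μ‖ ^ 2 ≤
      B ^ 2 * ‖vectorAvg (Q ×ˢ Q) fun p =>
        ∫ x, (c p.1 * star (c p.2)) x * conj (gowersDelta p.1 p.2 g x) ∂μ‖ := by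
  have := hX.isProbabilityMeasure
  let a : G → X → ℂ := fun n => c n * star (actionTranslate n g)
  have ha : ∀ n, BddBy A (a n) := fun n => by
    simpa using (hc n).mul hA (hg.translate hX n).star
  have hw : BddBy A (fun x => vectorAvg Q fun n => a n x) := by
    have := BddBy.vectorAvg hA Q fun n _ => ha n
    convert this using 1
    funext x
    rw [vectorAvg_apply]
  have e1 : (vectorAvg Q fun n => ∫ x, (c n * h) x * conj (actionTranslate n g x) ∂μ) =
      ∫ x, h x * vectorAvg Q (fun n => a n x) ∂μ := by
    simp only [mul_vectorAvg]
    rw [integral_vectorAvg (F := fun n x => h x * a n x) _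
      fun n => (hh.mul hB (ha n)).integrable]
    refine vectorAvg_congr fun n _ => integral_congr_ae (.of_forall fun x => ?_)
    simp only [a, Pi.mul_apply, Pi.star_apply, starRingEnd_apply]
    ring
  have e2 : (vectorAvg (Q ×ˢ Q) fun p =>
        ∫ x, (c p.1 * star (c p.2)) x * conj (gowersDelta p.1 p.2 g x) ∂μ) =
      vectorAvg (Q ×ˢ Q) fun p => ∫ x, a p.1 x * conj (a p.2 x) ∂μ := by
    refine vectorAvg_congr fun p _ => integral_congr_ae (.of_forall fun x => ?_)
    simp only [a, gowersDelta, Pi.mul_apply, Pi.star_apply, starRingEnd_apply, star_mul',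
      star_star]
    ring
  rw [e1, e2, ← integral_norm_sq_vectorAvg hA Q ha, Complex.norm_real, Real.norm_of_nonneg
    (integral_nonneg fun x => by positivity)]
  calc ‖∫ x, h x * vectorAvg Q (fun n => a n x) ∂μ‖ ^ 2
      ≤ (B * ∫ x, ‖vectorAvg Q (fun n => a n x)‖ ∂μ) ^ 2 :=
        pow_le_pow_left₀ (norm_nonneg _) (norm_integral_mul_le hh hw) 2
    _ ≤ _ := by
        rw [mul_pow]
        exact mul_le_mul_of_nonneg_left (sq_integral_norm_le hw) (sq_nonneg _)

open scoped ComplexOrder in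
-- Gowers averages of positive order are nonnegative, so norms may be taken inside the defining
-- average.
theorem vectorAvg_norm_gowersAvg_delta (hX : IsGSystem G μ) (Q : Multiset G) (d : ℕ) {g : X → ℂ}
    (hg : BddBy 1 g) :
    (vectorAvg (Q ×ˢ Q) fun p => ‖gowersAvg μ Q (d + 1) (gowersDelta p.1 p.2 g)‖) =
      ‖gowersAvg μ Q (d + 2) g‖ := by
  have h : ((vectorAvg (Q ×ˢ Q) fun p =>
      ‖gowersAvg μ Q (d + 1) (gowersDelta p.1 p.2 g)‖ : ℝ) : ℂ) = gowersAvg μ Q (d + 2) g := by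
    rw [ofReal_vectorAvg, gowersAvg_succ]
    refine vectorAvg_congr fun p _ => ?_
    exact Complex.norm_of_nonneg' (gowersAvg_nonneg hX Q d _ (hg.gowersDelta hX p.1 p.2).memLp)
  rw [← h, Complex.norm_real, Real.norm_of_nonneg]
  have h0 : (vectorAvg (Q ×ˢ Q) fun _ => (0 : ℝ)) = 0 := by simp [vectorAvg]
  rw [← h0]
  exact vectorAvg_mono fun _ _ => norm_nonneg _

end CauchySchwarz

theorem AntiUniform.uniformlyBdd {P : ScaleFamily S} {d : ℕ} {F : FunctionClass S}
    (h : AntiUniform P d F) : UniformlyBdd F := by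
  cases d with
  | zero => exact (isMultiplicative_antiUniform_zero P).bdd h
  | succ d => exact h.1

/-- Anti-uniformity of order `d` is used here against the derivatives of `g`, whose `U^d` seminorms
are small only on average. Markov's inequality bounds the contribution of the exceptional pairs. For
`d = 0` the average is itself the conjugate of the `U^1` average of `g`. -/
theorem AntiUniform.exists_correlation_le {P : ScaleFamily S} {d : ℕ} {F : FunctionClass S}
    (h : AntiUniform P d F) {δ : ℝ} (hδ : 0 < δ) :
    ∃ ε₀ : ℝ, 0 < ε₀ ∧ ∀ ε : ℝ, 0 < ε → ε ≤ ε₀ → ∀ i, ∀ g, BddBy 1 g →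
      ‖gowersAvg (S i).μ (P.Q i ε) (d + 1) g‖ ≤ ε ^ 2 ^ (d + 1) →
      ∀ c : (S i).G × (S i).G → (S i).X → ℂ, (∀ p, c p ∈ F i) →
        ‖vectorAvg (P.Q i ε ×ˢ P.Q i ε) fun p =>
          ∫ x, c p x * conj (gowersDelta p.1 p.2 g x) ∂(S i).μ‖ ≤ δ := by
  cases d with
  | zero =>
    refine ⟨min 1 δ, by positivity, fun ε hε hle i g hg hgU c hc => ?_⟩
    have e : (vectorAvg (P.Q i ε ×ˢ P.Q i ε) fun p =>
        ∫ x, c p x * conj (gowersDelta p.1 p.2 g x) ∂(S i).μ) =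
        conj (gowersAvg (S i).μ (P.Q i ε) 1 g) := by
      rw [gowersAvg_succ, conj_vectorAvg]
      refine vectorAvg_congr fun p _ => ?_
      have hcp : c p = 1 := h i (hc p)
      rw [hcp, gowersAvg, ← integral_conj]
      simp
    rw [e, RCLike.norm_conj]
    refine hgU.trans ?_
    have h1 := hle.trans (min_le_left _ _)
    have h2 := hle.trans (min_le_right _ _)
    norm_num
    nlinarith
  | succ d =>
    obtain ⟨⟨M, hM, hb⟩, hF⟩ := h
    obtain ⟨ε₀, hε₀, hF⟩ := hF (δ / 2) (by positivity)
    refine ⟨min ε₀ (min 1 (δ / (2 * (M + 1)))), by positivity, fun ε hε hle i g hg hgU c hc => ?_⟩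
    have hX := (S i).isGSystem
    have h0 := hle.trans (min_le_left _ _)
    have h1 := (hle.trans (min_le_right _ _)).trans (min_le_left _ _)
    have h2 := (hle.trans (min_le_right _ _)).trans (min_le_right _ _)
    -- The threshold `t` for good pairs is the square root of the assumed bound on `g`, so the
    -- exceptional pairs cost at most `(M / t) * t² = M * t`.
    set t := ε ^ 2 ^ (d + 1) with ht
    have ht0 : 0 < t := by positivity
    have htε : t ≤ ε := pow_le_of_le_one hε.le h1 (by positivity)
    have htt : ε ^ 2 ^ (d + 1 + 1) = t * t := by rw [ht, ← pow_add]; congr 1; ring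
    have hp : ∀ p : (S i).G × (S i).G, ‖∫ x, c p x * conj (gowersDelta p.1 p.2 g x) ∂(S i).μ‖ ≤
        δ / 2 + (M / t) * ‖gowersAvg (S i).μ (P.Q i ε) (d + 1) (gowersDelta p.1 p.2 g)‖ := by
      intro p
      have hgd := hg.gowersDelta hX p.1 p.2
      rcases le_or_gt ‖gowersAvg (S i).μ (P.Q i ε) (d + 1) (gowersDelta p.1 p.2 g)‖ t with hs | hs
      · exact (hF ε hε h0 i _ (hc p) _ hgd hs).trans (le_add_of_nonneg_right (by positivity))
      · have := ((hb i _ (hc p)).mul hM hgd.star).norm_integral_le (μ := (S i).μ)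
        rw [mul_one] at this
        refine this.trans ?_
        have : M ≤ (M / t) * ‖gowersAvg (S i).μ (P.Q i ε) (d + 1) (gowersDelta p.1 p.2 g)‖ := by
          rw [div_mul_eq_mul_div, le_div_iff₀ ht0]
          exact mul_le_mul_of_nonneg_left hs.le hM
        linarith
    refine (norm_vectorAvg_le_vectorAvg _ _).trans ((vectorAvg_mono fun p _ => hp p).trans ?_)
    have hQ : P.Q i ε ×ˢ P.Q i ε ≠ 0 := by
      rw [Ne, ← Multiset.card_eq_zero]
      simp [P.ne_zero i ε]
    rw [vectorAvg_add, vectorAvg_const hQ]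
    have e : (vectorAvg (P.Q i ε ×ˢ P.Q i ε) fun p =>
        (M / t) * ‖gowersAvg (S i).μ (P.Q i ε) (d + 1) (gowersDelta p.1 p.2 g)‖) =
        (M / t) * vectorAvg (P.Q i ε ×ˢ P.Q i ε) fun p =>
          ‖gowersAvg (S i).μ (P.Q i ε) (d + 1) (gowersDelta p.1 p.2 g)‖ :=
      (map_vectorAvg (LinearMap.mulLeft ℝ (M / t)) _ _).symm
    rw [e, vectorAvg_norm_gowersAvg_delta hX _ _ hg]
    have h3 : (M / t) * ‖gowersAvg (S i).μ (P.Q i ε) (d + 1 + 1) g‖ ≤ (M / t) * (t * t) :=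
      mul_le_mul_of_nonneg_left (hgU.trans_eq htt) (by positivity)
    have h4 : (M / t) * (t * t) = M * t := by field_simp
    have h5 : M * t ≤ M * (δ / (2 * (M + 1))) := mul_le_mul_of_nonneg_left (htε.trans h2) hM
    have h6 : M * (δ / (2 * (M + 1))) ≤ δ / 2 := by
      rw [mul_div_assoc', div_le_div_iff₀ (by positivity) (by positivity)]
      nlinarith
    linarith

/-- Almost periodic classes with coefficients of order `d` are anti-uniform of order `d + 1`. -/
theorem AlmostPeriodic.antiUniform_succ {P : ScaleFamily S} {d : ℕ}
    (hd : IsMultiplicative (AntiUniform P d)) {F : FunctionClass S}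
    (h : AlmostPeriodic P (AntiUniform P d) UniformlyBdd F) : AntiUniform P (d + 1) F := by
  refine ⟨h.1, fun δ hδ => ?_⟩
  obtain ⟨η, hη, C, hC, H, ⟨B, hB, hHb⟩, hv⟩ := h.2 (δ / 2) (by positivity)
  obtain ⟨M, hM, hFb⟩ := h.1
  obtain ⟨A, hA, hCb⟩ := hC.uniformlyBdd
  obtain ⟨ε₁, hε₁, hcorr⟩ := (hd.mul hC (hd.star hC)).exists_correlation_le
    (δ := (δ / 2) ^ 2 / (B ^ 2 + 1)) (by positivity)
  refine ⟨min η ε₁, lt_min hη hε₁, fun ε hε hle i f hf g hg hgU => ?_⟩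
  have hX := (S i).isGSystem
  have hgt := fun n => hg.translate hX n
  obtain ⟨v, hv, hfv⟩ := hv i f hf
  -- The correlation bound cuts out a convex set of families, so it suffices to treat the generators
  -- `c n * h`; boundedness is carried along for integrability.
  have key : v ∈ {v : (S i).G → (S i).X → ℂ | (∀ n, BddBy (A * B) (v n)) ∧
      ‖vectorAvg (P.Q i ε) fun n =>
        ∫ x, v n x * conj (actionTranslate n g x) ∂(S i).μ‖ ≤ δ / 2} := by
    refine convexHull_min ?_ ?_ hv
    · rintro _ ⟨c, hc, h, hh, rfl⟩
      refine ⟨fun n => (hCb i _ (hc n)).mul hA (hHb i _ hh), ?_⟩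
      have h1 := sq_norm_correlation_le hX (P.Q i ε) hA (fun n => hCb i _ (hc n)) hB
        (hHb i _ hh) hg
      have h2 := hcorr ε hε (hle.trans (min_le_right _ _)) i g hg hgU
        (fun p => c p.1 * star (c p.2)) fun p => ⟨_, hc p.1, _, ⟨_, hc p.2, rfl⟩, rfl⟩
      refine abs_le_of_sq_le_sq' ?_ (by positivity) |>.2
      refine h1.trans ((mul_le_mul_of_nonneg_left h2 (sq_nonneg B)).trans ?_)
      rw [mul_div_assoc', div_le_iff₀ (by positivity)]
      nlinarith [sq_nonneg (δ / 2)]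
    · rintro w ⟨hw, hwn⟩ w' ⟨hw', hwn'⟩ a b ha hb hab
      refine ⟨fun n => BddBy.convex _ (hw n) (hw' n) ha hb hab, ?_⟩
      have hi : ∀ {w : (S i).G → (S i).X → ℂ}, (∀ n, BddBy (A * B) (w n)) → ∀ n,
          Integrable (fun x => w n x * conj (actionTranslate n g x)) (S i).μ := fun hw n =>
        ((hw n).mul (mul_nonneg hA hB) (hgt n).star).integrable
      have e : (vectorAvg (P.Q i ε) fun n =>
          ∫ x, (a • w + b • w') n x * conj (actionTranslate n g x) ∂(S i).μ) =
          a • (vectorAvg (P.Q i ε) fun n =>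
            ∫ x, w n x * conj (actionTranslate n g x) ∂(S i).μ) +
          b • vectorAvg (P.Q i ε) fun n =>
            ∫ x, w' n x * conj (actionTranslate n g x) ∂(S i).μ := by
        have es : ∀ (a : ℝ) (F : (S i).G → ℂ), a • vectorAvg (P.Q i ε) F =
            vectorAvg (P.Q i ε) fun n => a • F n := fun a F =>
          map_vectorAvg (LinearMap.lsmul ℝ ℂ a) _ _
        rw [es, es, ← vectorAvg_add]
        refine vectorAvg_congr fun n _ => ?_
        rw [← integral_smul, ← integral_smul]
        refine .trans ?_ (integral_add ((hi hw n).smul a) ((hi hw' n).smul b))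
        refine integral_congr_ae (.of_forall fun x => ?_)
        simp only [Pi.add_apply, Pi.smul_apply, add_mul, smul_mul_assoc]
      have := convex_closedBall (0 : ℂ) (δ / 2) (mem_closedBall_zero_iff.2 hwn)
        (mem_closedBall_zero_iff.2 hwn') ha hb hab
      rw [mem_closedBall_zero_iff] at this
      rwa [e]
  obtain ⟨hvb, hvn⟩ := key
  -- Translating `f` and `g` by the same `n` leaves the correlation unchanged. After averaging over
  -- `n`, replacing `T^n f` by `v n` costs only their `L¹` distance.
  have e : ∫ x, f x * conj (g x) ∂(S i).μ =
      (vectorAvg (P.Q i ε) fun n => ∫ x, (actionTranslate n f x - v n x) *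
        conj (actionTranslate n g x) ∂(S i).μ) +
      vectorAvg (P.Q i ε) fun n => ∫ x, v n x * conj (actionTranslate n g x) ∂(S i).μ := by
    rw [← vectorAvg_add, ← vectorAvg_const (P.ne_zero i ε) (∫ x, f x * conj (g x) ∂(S i).μ)]
    refine vectorAvg_congr fun n _ => ?_
    rw [← integral_translate hX n fun x => f x * conj (g x)]
    refine .trans ?_ (integral_add
      ((((hFb i f hf).translate hX n).sub (hvb n)).mul (by positivity) (hgt n).star).integrable
      ((hvb n).mul (mul_nonneg hA hB) (hgt n).star).integrable)
    refine integral_congr_ae (.of_forall fun x => ?_)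
    simp only [actionTranslate, starRingEnd_apply]
    ring
  rw [e]
  refine (norm_add_le _ _).trans ?_
  have h1 : ‖vectorAvg (P.Q i ε) fun n => ∫ x, (actionTranslate n f x - v n x) *
        conj (actionTranslate n g x) ∂(S i).μ‖ ≤ δ / 2 := by
    refine norm_vectorAvg_le _ (by positivity) fun n hn => ?_
    simp only [mul_comm _ (conj (actionTranslate n g _))]
    refine (norm_integral_mul_le (hgt n).star
      (((hFb i f hf).translate hX n).sub (hvb n))).trans ?_
    rw [one_mul]
    exact hfv ε hε (hle.trans (min_le_left _ _)) n hn
  linarith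

/-! ### Almost periodicity of dual functions. -/

/-- The cofactors of the functions of a class at scale `ε`. -/
def cofactorClass (P : ScaleFamily S) (ε : ℝ) (d : ℕ) (F : FunctionClass S) : FunctionClass S :=
  fun i => gowersCofactor (P.Q i ε) d '' F i

theorem ScaleFamily.product_ne_zero (P : ScaleFamily S) (i : I) (ε : ℝ) :
    P.Q i ε ×ˢ P.Q i ε ≠ 0 := by
  rw [Ne, ← Multiset.card_eq_zero]
  simp [P.ne_zero i ε]

/-- A cofactor is a convex combination of products of translates and conjugates of `f`, all of which
stay in an invariant algebra. -/
theorem cofactorClass_mem {Y : FunctionClass S → Prop} (hY : IsInvariantAlg Y)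
    (P : ScaleFamily S) (ε : ℝ) (d : ℕ) {F : FunctionClass S} (hF : Y F) :
    Y (cofactorClass P ε d F) := by
  induction d generalizing F with
  | zero =>
    refine hY.mono ?_ hY.one
    rintro i _ ⟨f, hf, rfl⟩
    rfl
  | succ d ih =>
    have hs := hY.star (hY.translates hF)
    refine hY.mono ?_ (hY.hull (hY.mul hs (ih (hY.mul hF hs))))
    rintro i _ ⟨f, hf, rfl⟩
    refine vectorAvg_mem (convex_convexHull ℝ _) (P.product_ne_zero i ε)
      fun p _ => subset_convexHull ℝ _ ?_
    have hm : star (actionTranslate (p.2 - p.1) f) ∈ conjClass (translates F) i :=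
      ⟨_, ⟨_, f, hf, rfl⟩, rfl⟩
    exact ⟨_, hm, _, ⟨_, ⟨f, hf, _, hm, rfl⟩, rfl⟩, rfl⟩

/-- In the translate by `n` of a cofactor, the shift is absorbed into the variable `h'`, except in
one occurrence of `T^n f` inside the lower-order cofactor. That cofactor is the coefficient, and
`star (T^{h'-h} f)` is the factor independent of `n`. -/
theorem almostPeriodic_cofactorClass {Y : FunctionClass S → Prop}
    (hY : IsInvariantAlg Y) (P : ScaleFamily S) {ε : ℝ} (hε : 0 < ε) {d : ℕ}
    (hd : ∀ F : FunctionClass S, (∀ i, ∀ f ∈ F i, BddBy 1 f) →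
      AntiUniform P d (cofactorClass P ε d F)) {F : FunctionClass S}
    (hF : Y F) (hb : ∀ i, ∀ f ∈ F i, BddBy 1 f) :
    AlmostPeriodic P (fun F => AntiUniform P d F ∧ Y F) Y (cofactorClass P ε (d + 1) F) := by
  refine ⟨cofactorClass_mem hY P ε (d + 1) hF, fun κ hκ => ?_⟩
  obtain ⟨η, hη, hshift⟩ := P.shift ε hε κ hκ
  have hs := hY.star (hY.translates hF)
  refine ⟨η, hη, _, ⟨hd (mulClass (translates F) (conjClass (translates F))) ?_,
    cofactorClass_mem hY P ε d (hY.mul (hY.translates hF) hs)⟩, _, hs, ?_⟩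
  · rintro i _ ⟨_, ⟨m, f, hf, rfl⟩, _, ⟨_, ⟨n, f', hf', rfl⟩, rfl⟩, rfl⟩
    have hX := (S i).isGSystem
    simpa using ((hb i f hf).translate hX m).mul zero_le_one ((hb i f' hf').translate hX n).star
  rintro i _ ⟨f, hf, rfl⟩
  have hX := (S i).isGSystem
  have hfb := hb i f hf
  let Q := P.Q i ε
  refine ⟨vectorAvg (Q ×ˢ Q) fun p n =>
    gowersCofactor Q d (actionTranslate n f * star (actionTranslate (p.2 - p.1) f)) *
      star (actionTranslate (p.2 - p.1) f),
    vectorAvg_mem (convex_convexHull ℝ _) (P.product_ne_zero i ε)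
      fun p _ => subset_convexHull ℝ _ ?_, fun ζ h0 hζ n hn => ?_⟩
  · have hm : star (actionTranslate (p.2 - p.1) f) ∈ conjClass (translates F) i :=
      ⟨_, ⟨_, f, hf, rfl⟩, rfl⟩
    exact ⟨_, fun n => ⟨_, ⟨_, ⟨n, f, hf, rfl⟩, _, hm, rfl⟩, rfl⟩, _, hm, rfl⟩
  · refine l1Dist_le_of_forall fun x => ?_
    rw [← gowersCofactor_translate, vectorAvg_apply, vectorAvg_apply]
    simp only [gowersCofactor]
    rw [vectorAvg_apply]
    -- At a fixed point `x` the translated cofactor averages `φ (h' + n - h)`, while the approximant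
    -- averages `φ (h' - h)`; here `n` is also fixed inside `φ`.
    let φ : (S i).G → ℂ := fun m => star (actionTranslate m f) x *
      gowersCofactor Q d (actionTranslate n f * star (actionTranslate m f)) x
    have hφ : ∀ m, ‖φ m‖ ≤ 1 := fun m => by
      have h1 := (hfb.translate hX m).star
      have h2 : BddBy 1 (actionTranslate n f * star (actionTranslate m f)) := by
        simpa using (hfb.translate hX n).mul zero_le_one h1
      simpa [φ] using (h1.mul zero_le_one (h2.gowersCofactor hX Q d)).2 x
    have e1 : (vectorAvg (Q ×ˢ Q) fun p => (star (actionTranslate (p.2 - p.1)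
        (actionTranslate n f)) * gowersCofactor Q d (actionTranslate n f *
          star (actionTranslate (p.2 - p.1) (actionTranslate n f)))) x) =
        vectorAvg Q fun h => vectorAvg Q fun h' => φ (h' + n - h) := by
      rw [vectorAvg_product]
      refine vectorAvg_congr fun h _ => vectorAvg_congr fun h' _ => ?_
      have : h' + n - h = h' - h + n := by abel
      simp only [φ, this, actionTranslate_add]
      rfl
    have e2 : (vectorAvg (Q ×ˢ Q) fun p => (gowersCofactor Q d (actionTranslate n f *
        star (actionTranslate (p.2 - p.1) f)) * star (actionTranslate (p.2 - p.1) f)) x) =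
        vectorAvg Q fun h => vectorAvg Q fun h' => φ (h' - h) := by
      rw [vectorAvg_product]
      refine vectorAvg_congr fun h _ => vectorAvg_congr fun h' _ => mul_comm _ _
    change ‖(vectorAvg (Q ×ˢ Q) fun p => (star (actionTranslate (p.2 - p.1)
        (actionTranslate n f)) * gowersCofactor Q d (actionTranslate n f *
          star (actionTranslate (p.2 - p.1) (actionTranslate n f)))) x) -
      vectorAvg (Q ×ˢ Q) (fun p => (gowersCofactor Q d (actionTranslate n f *
        star (actionTranslate (p.2 - p.1) f)) * star (actionTranslate (p.2 - p.1) f)) x)‖ ≤ κ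
    rw [e1, e2, vectorAvg_sub]
    exact norm_vectorAvg_le _ hκ.le fun h _ =>
      hshift ζ h0 hζ i n hn (fun h' => φ (h' - h)) fun _ => hφ _

/-! ### Energy decrement. -/

/-- The radial retraction of `ℂ` onto the closed unit disc. -/
def discRetraction (z : ℂ) : ℂ := (max 1 ‖z‖)⁻¹ • z

theorem continuous_discRetraction : Continuous discRetraction := by
  unfold discRetraction
  exact ((continuous_const.max continuous_norm).inv₀
    fun z => (lt_max_of_lt_left one_pos).ne').smul continuous_id

theorem norm_discRetraction_le (z : ℂ) : ‖discRetraction z‖ ≤ 1 := by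
  rw [discRetraction, norm_smul, Real.norm_of_nonneg (by positivity), inv_mul_eq_div]
  exact div_le_one_of_le₀ (le_max_right _ _) (by positivity)

/-- Retracting an approximant to the unit disc never moves it away from a 1-bounded function, so
approximants can be kept 1-bounded without losing energy decrement. The retraction is continuous,
hence available in every algebraic collection. -/
theorem norm_sub_discRetraction_le {a : ℂ} (ha : ‖a‖ ≤ 1) (z : ℂ) :
    ‖a - discRetraction z‖ ≤ ‖a - z‖ := by
  rcases le_or_gt ‖z‖ 1 with h | h
  · simp [discRetraction, max_eq_left h]
  · rw [discRetraction, max_eq_right h.le]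
    refine abs_le_of_sq_le_sq' ?_ (norm_nonneg _) |>.2
    have h0 : 0 < ‖z‖ := one_pos.trans h
    rw [norm_sub_sq_real, norm_sub_sq_real, inner_smul_right, norm_smul,
      Real.norm_of_nonneg (by positivity), inv_mul_cancel₀ h0.ne']
    have hi : inner ℝ a z ≤ ‖z‖ :=
      (real_inner_le_norm a z).trans (mul_le_of_le_one_left h0.le ha)
    have hk : inner ℝ a z * (1 - ‖z‖⁻¹) ≤ ‖z‖ * (1 - ‖z‖⁻¹) :=
      mul_le_mul_of_nonneg_right hi (sub_nonneg.2 (inv_le_one_of_one_le₀ h.le))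
    have he : ‖z‖ * (1 - ‖z‖⁻¹) = ‖z‖ - 1 := by field_simp
    nlinarith [sq_nonneg (‖z‖ - 1)]

section Energy

variable {X : Type v} [MeasurableSpace X] {μ : Measure X} [IsProbabilityMeasure μ]

theorem BddBy.integrable_norm_sq {M : ℝ} {f : X → ℂ} (hf : BddBy M f) :
    Integrable (fun x => ‖f x‖ ^ 2) μ := by
  refine Integrable.of_bound (hf.1.norm.pow_const 2).aestronglyMeasurable (M ^ 2)
    (.of_forall fun x => ?_)
  rw [Real.norm_of_nonneg (by positivity)]
  exact pow_le_pow_left₀ (norm_nonneg _) (hf.2 x) 2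

theorem BddBy.integrable_mul_conj {M B : ℝ} {f g : X → ℂ} (hM : 0 ≤ M) (hf : BddBy M f)
    (hg : BddBy B g) : Integrable (fun x => f x * conj (g x)) μ :=
  (hf.mul hM hg.star).integrable

theorem re_integral_mul_conj_comm {M B : ℝ} {f g : X → ℂ} (hM : 0 ≤ M) (hB : 0 ≤ B)
    (hf : BddBy M f) (hg : BddBy B g) :
    (∫ x, f x * conj (g x) ∂μ).re = (∫ x, g x * conj (f x) ∂μ).re := by
  have h1 := integral_re (hf.integrable_mul_conj (μ := μ) hM hg)
  have h2 := integral_re (hg.integrable_mul_conj (μ := μ) hB hf)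
  change _ = (∫ x, f x * conj (g x) ∂μ).re at h1
  change _ = (∫ x, g x * conj (f x) ∂μ).re at h2
  rw [← h1, ← h2]
  refine integral_congr_ae (.of_forall fun x => ?_)
  simp
  ring

theorem integral_norm_sub_smul_sq {M B : ℝ} {g h : X → ℂ} (hM : 0 ≤ M) (hg : BddBy M g)
    (hh : BddBy B h) (t : ℝ) :
    ∫ x, ‖g x - t * h x‖ ^ 2 ∂μ =
      ∫ x, ‖g x‖ ^ 2 ∂μ - 2 * t * (∫ x, g x * conj (h x) ∂μ).re + t ^ 2 * ∫ x, ‖h x‖ ^ 2 ∂μ := by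
  have hi := hg.integrable_mul_conj (μ := μ) hM hh
  have h1 := integral_re hi
  change _ = (∫ x, g x * conj (h x) ∂μ).re at h1
  have e : ∀ x, ‖g x - t * h x‖ ^ 2 =
      ‖g x‖ ^ 2 - 2 * t * (g x * conj (h x)).re + t ^ 2 * ‖h x‖ ^ 2 := fun x => by
    simp only [Complex.sq_norm, Complex.normSq_apply, Complex.sub_re, Complex.sub_im,
      Complex.mul_re, Complex.mul_im, Complex.conj_re, Complex.conj_im, Complex.ofReal_re,
      Complex.ofReal_im]
    ring
  simp only [e]
  rw [← h1, ← integral_const_mul, ← integral_const_mul]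
  refine (integral_add (hg.integrable_norm_sq.sub (hi.re.const_mul _))
    (hh.integrable_norm_sq.const_mul _)).trans ?_
  congr 1
  exact integral_sub hg.integrable_norm_sq (hi.re.const_mul _)

theorem integral_norm_sq_le_one {f : X → ℂ} (hf : BddBy 1 f) : ∫ x, ‖f x‖ ^ 2 ∂μ ≤ 1 := by
  have : ∫ x, ‖f x‖ ^ 2 ∂μ ≤ ∫ _, (1 : ℝ) ∂μ :=
    integral_mono hf.integrable_norm_sq (integrable_const _)
      fun x => pow_le_one₀ (norm_nonneg _) (hf.2 x)
  simpa using this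

/-- Expanding the square, the cross term contributes at most `-t * e` and the quadratic term at most
`t² ≤ t * e / 2`. -/
theorem energy_shrink_le {f s : X → ℂ} (hf : BddBy 1 f) (hs : BddBy 1 s) {e t : ℝ} (ht : 0 ≤ t)
    (hte : t ≤ e / 2) (h : (∫ x, (f - s) x * conj (s x) ∂μ).re ≤ -(e / 2)) :
    ∫ x, ‖f x - ((1 - t : ℝ) : ℂ) * s x‖ ^ 2 ∂μ ≤ ∫ x, ‖f x - s x‖ ^ 2 ∂μ - t * e / 2 := by
  have h1 := integral_norm_sub_smul_sq (μ := μ) (by norm_num) (hf.sub hs) hs (-t)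
  have h2 : ∀ x, f x - ((1 - t : ℝ) : ℂ) * s x = (f - s) x - ((-t : ℝ) : ℂ) * s x := fun x => by
    simp only [Pi.sub_apply]
    push_cast
    ring
  simp only [h2]
  rw [h1]
  have h3 := integral_norm_sq_le_one (μ := μ) hs
  simp only [Pi.sub_apply] at h ⊢
  nlinarith [sq_nonneg t]

/-- The energy is `⟨f - s, f⟩ - ⟨f - s, s⟩`; if it exceeds `e`, one of the two terms must account
for `e / 2`. -/
theorem energy_dichotomy {f s : X → ℂ} (hf : BddBy 1 f) (hs : BddBy 1 s) {e : ℝ}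
    (h : e < ∫ x, ‖f x - s x‖ ^ 2 ∂μ) :
    e / 2 < ‖∫ x, f x * conj ((f - s) x) ∂μ‖ ∨
      (∫ x, (f - s) x * conj (s x) ∂μ).re ≤ -(e / 2) := by
  by_contra! hc
  have hg := hf.sub hs
  have h1 : ((∫ x, ‖f x - s x‖ ^ 2 ∂μ : ℝ) : ℂ) =
      ∫ x, (f - s) x * conj (f x) ∂μ - ∫ x, (f - s) x * conj (s x) ∂μ := by
    rw [← integral_sub (hg.integrable_mul_conj (by norm_num) hf)
      (hg.integrable_mul_conj (by norm_num) hs), ← integral_complex_ofReal]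
    refine integral_congr_ae (.of_forall fun x => ?_)
    simp only
    rw [← Complex.normSq_eq_norm_sq, ← Complex.mul_conj, ← mul_sub, ← map_sub]
    rfl
  have h2 := congrArg Complex.re h1
  rw [Complex.ofReal_re, Complex.sub_re, re_integral_mul_conj_comm (by norm_num) zero_le_one hg hf]
    at h2
  have h3 := (Complex.re_le_norm (∫ x, f x * conj ((f - s) x) ∂μ)).trans hc.1
  linarith [hc.2]

open scoped ComplexOrder in
-- The conjugate cofactor of `(f - s) / 2` has correlation at least `2 * a` with `f - s`. A step of
-- length `a` in its direction changes the energy by at most `-4 * a² + a²`. The factor `1 / 2`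
-- keeps the function 1-bounded.
theorem energy_cofactor_step_le {G : Type u} [AddCommGroup G] [AddAction G X]
    (hX : IsGSystem G μ) (Q : Multiset G) (d : ℕ) {f s : X → ℂ} (hf : BddBy 1 f)
    (hs : BddBy 1 s) {a : ℝ} (ha : 0 ≤ a)
    (h : a ≤ ‖gowersAvg μ Q (d + 1) ((fun _ => 1 / 2) * (f - s))‖) :
    ∫ x, ‖f x - discRetraction (s x + a *
      conj (gowersCofactor Q (d + 1) ((fun _ => 1 / 2) * (f - s)) x))‖ ^ 2 ∂μ ≤
      ∫ x, ‖f x - s x‖ ^ 2 ∂μ - 3 * a ^ 2 := by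
  have hg := hf.sub hs
  set g' : X → ℂ := (fun _ => 1 / 2) * (f - s) with hg'
  have hgb : BddBy 1 g' := by
    have := (BddBy.const (X := X) (1 / 2 : ℂ) (M := 1 / 2) (by simp)).mul (by norm_num) hg
    norm_num at this
    exact this
  have hc := hgb.gowersCofactor hX Q (d + 1)
  have hcs := hc.star
  have hsa : BddBy (1 + a) fun x => s x + a * conj (gowersCofactor Q (d + 1) g' x) := by
    have := hs.add ((BddBy.const (X := X) (a : ℂ) (M := a) (by simp [abs_of_nonneg ha])).mul ha hcs)
    rw [mul_one] at this
    exact this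
  have hret : BddBy 1 fun x => discRetraction
      (s x + a * conj (gowersCofactor Q (d + 1) g' x)) :=
    ⟨continuous_discRetraction.measurable.comp hsa.1, fun x => norm_discRetraction_le _⟩
  have h1 : ∫ x, ‖f x - discRetraction (s x + a * conj (gowersCofactor Q (d + 1) g' x))‖ ^ 2 ∂μ ≤
      ∫ x, ‖(f - s) x - a * star (gowersCofactor Q (d + 1) g') x‖ ^ 2 ∂μ := by
    have e : ∀ x, (f - s) x - a * star (gowersCofactor Q (d + 1) g') x =
        f x - (s x + a * conj (gowersCofactor Q (d + 1) g' x)) := fun x => by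
      simp only [Pi.sub_apply, Pi.star_apply, starRingEnd_apply]
      ring
    simp only [e]
    exact integral_mono (hf.sub hret).integrable_norm_sq (hf.sub hsa).integrable_norm_sq
      fun x => pow_le_pow_left₀ (norm_nonneg _) (norm_sub_discRetraction_le (hf.2 x) _) 2
  refine h1.trans ?_
  rw [integral_norm_sub_smul_sq (by norm_num) hg hcs]
  have h2 := integral_norm_sq_le_one (μ := μ) hcs
  have h3 : ∫ x, (f - s) x * conj (star (gowersCofactor Q (d + 1) g') x) ∂μ =
      2 * gowersAvg μ Q (d + 1) g' := by
    rw [← integral_mul_gowersCofactor hX hgb, ← integral_const_mul]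
    refine integral_congr_ae (.of_forall fun x => ?_)
    simp only [hg', Pi.mul_apply, Pi.star_apply, starRingEnd_apply, star_star]
    ring
  have h4 := Complex.norm_of_nonneg' (gowersAvg_nonneg hX Q d g' hgb.memLp)
  have h5 : (2 * gowersAvg μ Q (d + 1) g').re = 2 * ‖gowersAvg μ Q (d + 1) g'‖ := by
    rw [← h4]
    simp
  rw [h3, h5]
  simp only [Pi.sub_apply] at h2 ⊢
  nlinarith [sq_nonneg a]

end Energy

/-- By energy decrement, an anti-uniform class in `Y` lies in every algebraic collection that contains
the cofactors of the classes in `Y`. -/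
theorem mem_of_antiUniform_of_bddBy_one (P : ScaleFamily S) {d : ℕ} {Z Y : FunctionClass S → Prop}
    (hZ : IsAlgCollection Z) (hY : IsAlgCollection Y) (hZY : ∀ F, Z F → Y F)
    (hcof : ∀ F ε, 0 < ε → Y F → (∀ i, ∀ f ∈ F i, BddBy 1 f) → Z (cofactorClass P ε (d + 1) F))
    {F : FunctionClass S} (hF : AntiUniform P (d + 1) F) (hFY : Y F)
    (hb : ∀ i, ∀ f ∈ F i, BddBy 1 f) : Z F := by
  refine hZ.lim hF.1 fun κ hκ => ?_
  -- The `L¹` distance is at most the `L²` distance, so energy `κ²` suffices.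
  set e := κ ^ 2 with he
  have he0 : 0 < e := by positivity
  -- The bound `e / 4` is half of the `e / 2` in `energy_dichotomy`, because the test function is
  -- `(f - s) / 2`.
  obtain ⟨ε₀, hε₀, hF⟩ := hF.2 (e / 4) (by positivity)
  set a := ε₀ ^ 2 ^ (d + 1) with ha
  have ha0 : 0 < a := by positivity
  set t := min 1 (e / 2) with ht
  have ht0 : 0 < t := by positivity
  -- A guaranteed energy loss per step, whichever of the two moves applies.
  set σ := min (3 * a ^ 2) (t * e / 2) with hσ
  have hσ0 : 0 < σ := by positivity
  have key : ∀ k : ℕ, ∃ T : FunctionClass S, Z T ∧ (∀ i, ∀ s ∈ T i, BddBy 1 s) ∧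
      ∀ i, ∀ f ∈ F i, ∃ s ∈ T i, ∫ x, ‖f x - s x‖ ^ 2 ∂(S i).μ ≤ e ∨
        ∫ x, ‖f x - s x‖ ^ 2 ∂(S i).μ ≤ 1 - k * σ := by
    intro k
    induction k with
    | zero =>
      refine ⟨_, hZ.const 0, ?_, fun i f hf => ⟨_, ⟨0, by simp, rfl⟩, Or.inr ?_⟩⟩
      · rintro i _ ⟨c, hc, rfl⟩
        exact BddBy.const c (hc.trans zero_le_one)
      · simpa using integral_norm_sq_le_one (μ := (S i).μ) (hb i f hf)
    | succ k ih =>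
      obtain ⟨T, hT, hTb, hTF⟩ := ih
      have hhalf : ∀ i, ∀ g ∈ (fun f => (fun _ => 1 / 2) * f) '' (F i - T i), BddBy 1 g := by
        rintro i _ ⟨_, ⟨f, hf, s, hs, rfl⟩, rfl⟩
        have := (BddBy.const (X := (S i).X) (1 / 2 : ℂ) (M := 1 / 2) (by simp)).mul (by norm_num)
          ((hb i f hf).sub (hTb i s hs))
        norm_num at this
        exact this
      have hC := hcof _ ε₀ hε₀ (hY.smul (hY.sub hFY (hZY _ hT)) (1 / 2)) hhalf
      have hU := hZ.comp_continuous (hZ.add hT (hZ.smul (hZ.star hC) a)) continuous_discRetraction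
      have hV := hZ.smul hT ((1 - t : ℝ) : ℂ)
      -- Which move applies depends on `i` and `f`, so the new class keeps the old approximants
      -- along with the results of both moves.
      refine ⟨_, hZ.sup hT (hZ.sup hU hV), ?_, fun i f hf => ?_⟩
      · rintro i s (hs | hs | hs)
        · exact hTb i s hs
        · obtain ⟨M, hM, hMb⟩ := hZ.bdd hU
          refine ⟨(hMb i s hs).1, fun x => ?_⟩
          obtain ⟨g, hg, rfl⟩ := hs
          exact norm_discRetraction_le _
        · obtain ⟨s, hs, rfl⟩ := hs
          have h1 : ‖((1 - t : ℝ) : ℂ)‖ ≤ 1 := by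
            rw [Complex.norm_real, Real.norm_eq_abs, abs_le]
            have := min_le_left 1 (e / 2)
            constructor <;> linarith
          simpa using (BddBy.const (X := (S i).X) _ h1).mul zero_le_one (hTb i s hs)
      · obtain ⟨s, hs, h | h⟩ := hTF i f hf
        · exact ⟨s, Or.inl hs, Or.inl h⟩
        have hfb := hb i f hf
        have hsb := hTb i s hs
        rcases le_or_gt (∫ x, ‖f x - s x‖ ^ 2 ∂(S i).μ) e with hle | hlt
        · exact ⟨s, Or.inl hs, Or.inl hle⟩
        have hk : ((k + 1 : ℕ) : ℝ) = k + 1 := Nat.cast_succ k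
        rcases energy_dichotomy hfb hsb hlt with h1 | h1
        · have hgb := hhalf i _ ⟨_, ⟨f, hf, s, hs, rfl⟩, rfl⟩
          have h2 : a ≤ ‖gowersAvg (S i).μ (P.Q i ε₀) (d + 1) ((fun _ => 1 / 2) * (f - s))‖ := by
            by_contra! hlt
            have h3 := hF ε₀ hε₀ le_rfl i f hf _ hgb hlt.le
            have h4 : ∫ x, f x * conj ((1 / 2 : ℂ) * (f - s) x) ∂(S i).μ = 1 / 2 * ∫ x, f x * conj ((f - s) x) ∂(S i).μ := by
              rw [← integral_const_mul]
              refine integral_congr_ae (.of_forall fun x => ?_)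
              have : conj (1 / 2 : ℂ) = 1 / 2 := by rw [map_div₀, map_one, map_ofNat]
              simp only [map_mul, this]
              ring
            change ‖∫ x, f x * conj ((1 / 2 : ℂ) * (f - s) x) ∂(S i).μ‖ ≤ _ at h3
            rw [h4, norm_mul] at h3
            norm_num at h3
            simp only [Pi.sub_apply, map_sub] at h1
            linarith
          refine ⟨_, Or.inr (Or.inl ⟨_, ⟨s, hs, _, ⟨_, ⟨_, ⟨_, ⟨_, ⟨f, hf, s, hs, rfl⟩, rfl⟩, rfl⟩,
            rfl⟩, rfl⟩, rfl⟩, rfl⟩), Or.inr ?_⟩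
          have h5 := energy_cofactor_step_le (S i).isGSystem (P.Q i ε₀) d hfb hsb ha0.le h2
          have h6 : σ ≤ 3 * a ^ 2 := min_le_left _ _
          refine h5.trans ?_
          rw [hk]
          linarith
        · refine ⟨_, Or.inr (Or.inr ⟨s, hs, rfl⟩), Or.inr ?_⟩
          have h5 := energy_shrink_le hfb hsb ht0.le (min_le_right _ _) h1
          have h6 : σ ≤ t * e / 2 := min_le_right _ _
          refine h5.trans ?_
          rw [hk]
          linarith
  -- After this many steps `1 - k * σ` is negative, so the energy must already be at most `e`.
  obtain ⟨k, hk⟩ := exists_nat_gt (1 / σ)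
  rw [div_lt_iff₀ hσ0] at hk
  obtain ⟨T, hT, hTb, hTF⟩ := key k
  refine ⟨T, hT, fun i f hf => ?_⟩
  obtain ⟨s, hs, h⟩ := hTF i f hf
  refine ⟨s, hs, ?_⟩
  have h0 : 0 ≤ ∫ x, ‖f x - s x‖ ^ 2 ∂(S i).μ := integral_nonneg fun x => sq_nonneg _
  have h1 : ∫ x, ‖f x - s x‖ ^ 2 ∂(S i).μ ≤ e := h.resolve_right (by linarith)
  exact abs_le_of_sq_le_sq' ((sq_integral_norm_le ((hb i f hf).sub (hTb i s hs))).trans h1) hκ.le |>.2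

theorem AntiUniform.smul {P : ScaleFamily S} {d : ℕ} {F : FunctionClass S}
    (h : AntiUniform P (d + 1) F) {c : ℂ} (hc : ‖c‖ ≤ 1) :
    AntiUniform P (d + 1) fun i => (fun f => (fun _ => c) * f) '' F i := by
  refine ⟨isInvariantAlg_uniformlyBdd.smul h.1 c, fun δ hδ => ?_⟩
  obtain ⟨ε₀, hε₀, h⟩ := h.2 δ hδ
  refine ⟨ε₀, hε₀, fun ε hε hle i f' hf' g hg hgU => ?_⟩
  obtain ⟨f, hf, rfl⟩ := hf'
  have := h ε hε hle i f hf g hg hgU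
  simp only [Pi.mul_apply, mul_assoc]
  rw [integral_const_mul, norm_mul]
  exact (mul_le_of_le_one_left (norm_nonneg _) hc).trans this

/-- Rescaling by `(M + 1)⁻¹` reduces to 1-bounded classes. -/
theorem mem_of_antiUniform (P : ScaleFamily S) {d : ℕ} {Z Y : FunctionClass S → Prop}
    (hZ : IsAlgCollection Z) (hY : IsAlgCollection Y) (hZY : ∀ F, Z F → Y F)
    (hcof : ∀ F ε, 0 < ε → Y F → (∀ i, ∀ f ∈ F i, BddBy 1 f) → Z (cofactorClass P ε (d + 1) F))
    {F : FunctionClass S} (hF : AntiUniform P (d + 1) F) (hFY : Y F) : Z F := by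
  obtain ⟨M, hM, hb⟩ := hF.1
  have hM1 : 0 < M + 1 := by positivity
  have hc : ‖(((M + 1)⁻¹ : ℝ) : ℂ)‖ = (M + 1)⁻¹ := by
    rw [Complex.norm_real, Real.norm_of_nonneg (by positivity)]
  have h1 := mem_of_antiUniform_of_bddBy_one P hZ hY hZY hcof
    (hF.smul (c := (((M + 1)⁻¹ : ℝ) : ℂ)) (hc.trans_le (inv_le_one_of_one_le₀ (by linarith))))
    (hY.smul hFY _) (by
      rintro i _ ⟨f, hf, rfl⟩
      refine ((BddBy.const (X := (S i).X) _ hc.le).mul (by positivity) (hb i f hf)).mono ?_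
      rw [inv_mul_le_iff₀ hM1]
      linarith)
  refine hZ.mono ?_ (hZ.smul h1 (M + 1 : ℝ))
  intro i f hf
  refine ⟨_, ⟨f, hf, rfl⟩, ?_⟩
  funext x
  have : ((M + 1 : ℝ) : ℂ) ≠ 0 := by exact_mod_cast hM1.ne'
  simp only [Pi.mul_apply]
  rw [Complex.ofReal_inv, ← mul_assoc, mul_inv_cancel₀ this, one_mul]

/-! ### Anti-uniformity of order `d + 1` is almost periodicity over order `d`. -/

theorem AlmostPeriodic.mono_left {P : ScaleFamily S} {Z Z' Y : FunctionClass S → Prop}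
    (hZ : ∀ F, Z F → Z' F) {F : FunctionClass S} (h : AlmostPeriodic P Z Y F) :
    AlmostPeriodic P Z' Y F := by
  refine ⟨h.1, fun κ hκ => ?_⟩
  obtain ⟨η, hη, C, hC, h⟩ := h.2 κ hκ
  exact ⟨η, hη, C, hZ _ hC, h⟩

/-- Both claims go through one induction. Multiplicativity at order `d` makes the almost periodic
classes an algebraic collection, and anti-uniform cofactors at order `d` serve as coefficients at
the next order. Together they identify order `d + 1` with almost periodicity, from which both claims
follow again. -/
theorem antiUniform_structure (P : ScaleFamily S) (d : ℕ) :
    IsMultiplicative (AntiUniform P d) ∧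
      ∀ ε : ℝ, 0 < ε → ∀ F : FunctionClass S, (∀ i, ∀ f ∈ F i, BddBy 1 f) →
        AntiUniform P d (cofactorClass P ε d F) := by
  induction d with
  | zero =>
    refine ⟨isMultiplicative_antiUniform_zero P, ?_⟩
    rintro ε hε F hF i _ ⟨f, hf, rfl⟩
    rfl
  | succ d ih =>
    have hZ := isAlgCollection_almostPeriodic P ih.1
      (isInvariantAlg_uniformlyBdd (S := S)).toIsAlgCollection
    have hcof : ∀ F ε, 0 < ε → UniformlyBdd F → (∀ i, ∀ f ∈ F i, BddBy 1 f) →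
        AlmostPeriodic P (AntiUniform P d) UniformlyBdd (cofactorClass P ε (d + 1) F) :=
      fun F ε hε hF hb => (almostPeriodic_cofactorClass isInvariantAlg_uniformlyBdd P hε
        (ih.2 ε hε) hF hb).mono_left fun _ h => h.1
    have heq : AntiUniform P (d + 1) = AlmostPeriodic P (AntiUniform P d) UniformlyBdd := by
      funext F
      exact propext ⟨fun h => mem_of_antiUniform P hZ
        isInvariantAlg_uniformlyBdd.toIsAlgCollection (fun _ h => h.1) hcof h h.1,
        fun h => h.antiUniform_succ ih.1⟩
    exact ⟨heq ▸ hZ.toIsMultiplicative,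
      fun ε hε F hF => heq ▸ hcof F ε hε ⟨1, zero_le_one, hF⟩ hF⟩

/-- Anti-uniform classes of order `d + 1` are almost periodic with coefficients of order `d`. -/
theorem AntiUniform.almostPeriodic (P : ScaleFamily S) (d : ℕ) {Y : FunctionClass S → Prop}
    (hY : IsInvariantAlg Y) {F : FunctionClass S} (hF : AntiUniform P (d + 1) F) (hFY : Y F) :
    AlmostPeriodic P (fun F => AntiUniform P d F ∧ Y F) Y F :=
  mem_of_antiUniform P (isAlgCollection_almostPeriodic P
    ((antiUniform_structure P d).1.inter hY.toIsMultiplicative) hY.toIsAlgCollection)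
    hY.toIsAlgCollection (fun _ h => h.1)
    (fun _ ε hε hF hb => almostPeriodic_cofactorClass hY P hε ((antiUniform_structure P d).2 ε hε)
      hF hb) hF hFY

/-- The algebra operations come from the identification with almost periodic classes. A translation
can be moved onto `g`, and a correlation bound survives convex combinations. -/
theorem isInvariantAlg_antiUniform (P : ScaleFamily S) (d : ℕ) :
    IsInvariantAlg (AntiUniform P (d + 1)) := by
  have hZ := isAlgCollection_almostPeriodic P (antiUniform_structure P d).1
    (isInvariantAlg_uniformlyBdd (S := S)).toIsAlgCollection
  have heq : AntiUniform P (d + 1) = AlmostPeriodic P (AntiUniform P d) UniformlyBdd := by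
    funext F
    exact propext ⟨fun h => (AntiUniform.almostPeriodic P d isInvariantAlg_uniformlyBdd h h.1).mono_left
      fun _ h => h.1, fun h => h.antiUniform_succ (antiUniform_structure P d).1⟩
  rw [← heq] at hZ
  refine { hZ with translates := fun {F} hF => ?_, hull := fun {F} hF => ?_ }
  · refine ⟨isInvariantAlg_uniformlyBdd.translates hF.1, fun δ hδ => ?_⟩
    obtain ⟨ε₀, hε₀, h⟩ := hF.2 δ hδ
    refine ⟨ε₀, hε₀, fun ε hε hle i f' hf' g hg hgU => ?_⟩
    obtain ⟨n, f, hf, rfl⟩ := hf'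
    have hX := (S i).isGSystem
    have := h ε hε hle i f hf _ (hg.translate hX (-n)) (by rwa [gowersAvg_translate hX])
    rw [← integral_translate hX n] at this
    simpa [actionTranslate] using this
  · refine ⟨isInvariantAlg_uniformlyBdd.hull hF.1, fun δ hδ => ?_⟩
    obtain ⟨M, hM, hb⟩ := hF.1
    obtain ⟨ε₀, hε₀, h⟩ := hF.2 δ hδ
    refine ⟨ε₀, hε₀, fun ε hε hle i f' hf' g hg hgU => ?_⟩
    have key : f' ∈ {f | BddBy M f ∧ ‖∫ x, f x * conj (g x) ∂(S i).μ‖ ≤ δ} := by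
      refine convexHull_min ?_ ?_ hf'
      · exact fun f hf => ⟨hb i f hf, h ε hε hle i f hf g hg hgU⟩
      rintro f ⟨hf, hfn⟩ f' ⟨hf', hfn'⟩ a b ha hb' hab
      refine ⟨BddBy.convex _ hf hf' ha hb' hab, ?_⟩
      have e : ∫ x, (a • f + b • f') x * conj (g x) ∂(S i).μ =
          a • ∫ x, f x * conj (g x) ∂(S i).μ + b • ∫ x, f' x * conj (g x) ∂(S i).μ := by
        rw [← integral_smul, ← integral_smul]
        refine .trans ?_ (integral_add ((hf.integrable_mul_conj hM hg).smul a)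
          ((hf'.integrable_mul_conj hM hg).smul b))
        refine integral_congr_ae (.of_forall fun x => ?_)
        simp only [Pi.add_apply, Pi.smul_apply, add_mul, smul_mul_assoc]
      have := convex_closedBall (0 : ℂ) δ (mem_closedBall_zero_iff.2 hfn)
        (mem_closedBall_zero_iff.2 hfn') ha hb' hab
      rw [mem_closedBall_zero_iff] at this
      rwa [e]
    exact key.2

/-! ### Concatenation. -/

/-- If the translates by `b n` of every `h ∈ H₁` are approximated by families modulated by `C₂`, then
the translates by `b n` of a family modulated by `C₁` over `H₁` are approximated by families modulated
by products of translates of `C₁` with `C₂`. -/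
theorem exists_mem_hull_shift {G : Type u} [AddCommGroup G] {X : Type v} [MeasurableSpace X]
    [AddAction G X] {μ : Measure X} (hX : IsGSystem G μ) {C₁ H₁ C₂ H₂ : Set (X → ℂ)}
    {A₁ B₁ A₂ B₂ κ : ℝ} (hA₁ : 0 ≤ A₁) (hA₂ : 0 ≤ A₂)
    (hC₁ : ∀ c ∈ C₁, BddBy A₁ c) (hH₁ : ∀ h ∈ H₁, BddBy B₁ h)
    (hC₂ : ∀ c ∈ C₂, BddBy A₂ c) (hH₂ : ∀ h ∈ H₂, BddBy B₂ h) (N : Set G) (a b : G → G)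
    (h : ∀ h ∈ H₁, ∃ w ∈ convexHull ℝ (modulated G C₂ H₂), ∀ n ∈ N,
      l1Dist μ (actionTranslate (b n) h) (w (b n)) ≤ κ)
    {v : G → X → ℂ} (hv : v ∈ convexHull ℝ (modulated G C₁ H₁)) :
    ∃ w ∈ convexHull ℝ (modulated G
      ({f | ∃ g : G, ∃ f' ∈ C₁, f = actionTranslate g f'} * C₂) H₂), ∀ n ∈ N,
        l1Dist μ (actionTranslate (b n) (v (a n))) (w n) ≤ A₁ * κ := by
  have := hX.isProbabilityMeasure
  set D := {f | ∃ g : G, ∃ f' ∈ C₁, f = actionTranslate g f'} * C₂ with hD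
  have hDb : ∀ c ∈ D, BddBy (A₁ * A₂) c := by
    rintro _ ⟨_, ⟨g, c, hc, rfl⟩, c', hc', rfl⟩
    exact ((hC₁ c hc).translate hX g).mul hA₁ (hC₂ c' hc')
  have key : v ∈ {v : G → X → ℂ | (∀ n, BddBy (A₁ * B₁) (v n)) ∧
      ∃ w ∈ convexHull ℝ (modulated G D H₂), ∀ n ∈ N,
        l1Dist μ (actionTranslate (b n) (v (a n))) (w n) ≤ A₁ * κ} := by
    refine convexHull_min ?_ ?_ hv
    · rintro _ ⟨c, hc, k, hk, rfl⟩
      refine ⟨fun n => (hC₁ _ (hc n)).mul hA₁ (hH₁ k hk), ?_⟩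
      obtain ⟨w, hw, hkw⟩ := h k hk
      -- For fixed `c`, passing from an approximation of `T^b h` to one of `T^b (c h)` is linear in
      -- the approximating family, hence respects convex hulls.
      let L : (G → X → ℂ) →ₗ[ℝ] (G → X → ℂ) :=
        { toFun := fun w n => actionTranslate (b n) (c (a n)) * w (b n)
          map_add' := fun w w' => by
            funext n
            exact mul_add _ _ _
          map_smul' := fun t w => by
            funext n
            exact mul_smul_comm t (actionTranslate (b n) (c (a n))) (w (b n)) }
      refine ⟨L w, map_mem_convexHull L ?_ hw, fun n hn => ?_⟩
      · rintro _ ⟨c', hc', k', hk', rfl⟩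
        refine ⟨fun n => actionTranslate (b n) (c (a n)) * c' (b n),
          fun n => ⟨_, ⟨_, _, hc _, rfl⟩, _, hc' _, rfl⟩, k', hk', ?_⟩
        funext n
        exact (mul_assoc _ _ _).symm
      · have hcb := (hC₁ _ (hc (a n))).translate hX (b n)
        refine (l1Dist_mul hA₁ hcb ((hH₁ k hk).translate hX (b n)) hcb
          (bddBy_of_mem_hull_modulated hA₂ hC₂ hH₂ hw (b n))).trans ?_
        rw [l1Dist_self, mul_zero, add_zero]
        exact mul_le_mul_of_nonneg_left (hkw n hn) hA₁
    · rintro v ⟨hv, w, hw, hvw⟩ v' ⟨hv', w', hw', hvw'⟩ s t hs ht hst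
      refine ⟨fun n => BddBy.convex _ (hv n) (hv' n) hs ht hst, s • w + t • w',
        convex_convexHull ℝ _ hw hw' hs ht hst, fun n hn => ?_⟩
      have hsm : ∀ {B t : ℝ} {f : X → ℂ}, 0 ≤ t → BddBy B f → BddBy (t * B) (t • f) :=
        fun {B t f} ht hf => ⟨hf.1.const_smul t, fun x => by
          rw [Pi.smul_apply, norm_smul, Real.norm_of_nonneg ht]
          exact mul_le_mul_of_nonneg_left (hf.2 x) ht⟩
      have hwb := bddBy_of_mem_hull_modulated (mul_nonneg hA₁ hA₂) hDb hH₂ hw n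
      have hwb' := bddBy_of_mem_hull_modulated (mul_nonneg hA₁ hA₂) hDb hH₂ hw' n
      refine (l1Dist_add (f := s • actionTranslate (b n) (v (a n)))
        (f' := t • actionTranslate (b n) (v' (a n)))
        (hsm hs ((hv (a n)).translate hX (b n))) (hsm ht ((hv' (a n)).translate hX (b n)))
        (hsm hs hwb) (hsm ht hwb')).trans ?_
      rw [l1Dist_smul hs, l1Dist_smul ht]
      have h1 := mul_le_mul_of_nonneg_left (hvw n hn) hs
      have h2 := mul_le_mul_of_nonneg_left (hvw' n hn) ht
      have h3 : s * (A₁ * κ) + t * (A₁ * κ) = A₁ * κ := by rw [← add_mul, hst, one_mul]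
      linarith
  exact key.2

/-- The concatenation theorem for uniform classes. -/
theorem AntiUniform.concatenation {P₁ P₂ P₃ : ScaleFamily S}
    (hP : ∀ i (η : ℝ), 0 < η → ∀ n ∈ P₃.Q i η, ∃ a ∈ P₁.Q i η, ∃ b ∈ P₂.Q i η, n = a + b)
    (d₁ d₂ : ℕ) {F : FunctionClass S} (h₁ : AntiUniform P₁ (d₁ + 1) F)
    (h₂ : AntiUniform P₂ (d₂ + 1) F) : AntiUniform P₃ (d₁ + d₂ + 1) F := by
  let Y : FunctionClass S → Prop :=
    fun F => AntiUniform P₁ (d₁ + 1) F ∧ AntiUniform P₂ (d₂ + 1) F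
  have hY : IsInvariantAlg Y :=
    (isInvariantAlg_antiUniform P₁ d₁).inter (isInvariantAlg_antiUniform P₂ d₂)
  have hm := (antiUniform_structure P₃ (d₁ + d₂)).1
  -- Induction hypothesis with the first order lowered by one. For `d₁ = 0` the coefficients are
  -- constantly 1, which is anti-uniform of every order.
  have hc₁ : ∀ C, AntiUniform P₁ d₁ C → Y C → AntiUniform P₃ (d₁ + d₂) C := by
    intro C hC hCY
    match d₁ with
    | 0 => exact hm.mono hC hm.one
    | e + 1 =>
      rw [Nat.add_right_comm]
      exact AntiUniform.concatenation hP e d₂ hC hCY.2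
  have hc₂ : ∀ C, AntiUniform P₂ d₂ C → Y C → AntiUniform P₃ (d₁ + d₂) C := by
    intro C hC hCY
    match d₂ with
    | 0 => exact hm.mono hC hm.one
    | e + 1 => exact AntiUniform.concatenation hP d₁ e hCY.1 hC
  refine AlmostPeriodic.antiUniform_succ hm ⟨h₁.1, fun κ hκ => ?_⟩
  obtain ⟨η₁, hη₁, C₁, hC₁, H₁, hH₁, hF⟩ :=
    (AntiUniform.almostPeriodic P₁ d₁ hY h₁ ⟨h₁, h₂⟩).2 (κ / 2) (by positivity)
  obtain ⟨M, hM, hFb⟩ := h₁.1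
  obtain ⟨A₁, hA₁, hCb₁⟩ := hY.bdd hC₁.2
  obtain ⟨B₁, hB₁, hHb₁⟩ := hY.bdd hH₁
  -- The class `H₁` lies in `Y`, so it is almost periodic in the second direction too.
  obtain ⟨η₂, hη₂, C₂, hC₂, H₂, hH₂, hH⟩ :=
    (AntiUniform.almostPeriodic P₂ d₂ hY hH₁.2 hH₁).2 (κ / (2 * (A₁ + 1))) (by positivity)
  obtain ⟨A₂, hA₂, hCb₂⟩ := hY.bdd hC₂.2
  obtain ⟨B₂, hB₂, hHb₂⟩ := hY.bdd hH₂
  have hCt : Y (translates C₁) := hY.translates hC₁.2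
  have hCt₁ : AntiUniform P₁ d₁ (translates C₁) := by
    match d₁ with
    | 0 =>
      rintro i _ ⟨g, c, hc, rfl⟩
      obtain rfl := hC₁.1 i hc
      rfl
    | e + 1 => exact (isInvariantAlg_antiUniform P₁ e).translates hC₁.1
  refine ⟨min η₁ η₂, lt_min hη₁ hη₂, mulClass (translates C₁) C₂,
    hm.mul (hc₁ _ hCt₁ hCt) (hc₂ _ hC₂.1 hC₂.2), H₂, hY.bdd hH₂, fun i f hf => ?_⟩
  have hX := (S i).isGSystem
  let N : Set (S i).G := {n | ∃ ζ : ℝ, 0 < ζ ∧ ζ ≤ min η₁ η₂ ∧ n ∈ P₃.Q i ζ}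
  -- The splitting is chosen once for each `n`, at some admissible scale that may differ from the
  -- scale considered later; both are below `η₁` and `η₂`, which is all that matters.
  have hdec : ∀ n : (S i).G, ∃ a b : (S i).G, n ∈ N → n = a + b ∧ ∃ ζ : ℝ, 0 < ζ ∧
      ζ ≤ min η₁ η₂ ∧ a ∈ P₁.Q i ζ ∧ b ∈ P₂.Q i ζ := fun n => by
    by_cases hn : n ∈ N
    · obtain ⟨ζ, h0, hζ, hn⟩ := hn
      obtain ⟨a, ha, b, hb, e⟩ := hP i ζ h0 n hn
      exact ⟨a, b, fun _ => ⟨e, ζ, h0, hζ, ha, hb⟩⟩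
    · exact ⟨0, 0, fun h => absurd h hn⟩
  choose a b hab using hdec
  obtain ⟨v, hv, hfv⟩ := hF i f hf
  obtain ⟨w, hw, hvw⟩ := exists_mem_hull_shift hX hA₁ hA₂ (hCb₁ i) (hHb₁ i) (hCb₂ i) (hHb₂ i)
    N a b (κ := κ / (2 * (A₁ + 1))) (fun h hh => by
      obtain ⟨w, hw, hhw⟩ := hH i h hh
      refine ⟨w, hw, fun n hn => ?_⟩
      obtain ⟨-, ζ, h0, hζ, -, hb⟩ := hab n hn
      exact hhw ζ h0 (hζ.trans (min_le_right _ _)) _ hb) hv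
  refine ⟨w, hw, fun ζ h0 hζ n hn => ?_⟩
  have hnN : n ∈ N := ⟨ζ, h0, hζ, hn⟩
  obtain ⟨e, ζ', h0', hζ', ha, -⟩ := hab n hnN
  have hwb : BddBy (A₁ * A₂ * B₂) (w n) := by
    refine bddBy_of_mem_hull_modulated (mul_nonneg hA₁ hA₂) ?_ (hHb₂ i) hw n
    rintro _ ⟨_, ⟨g, c, hc, rfl⟩, c', hc', rfl⟩
    exact ((hCb₁ i c hc).translate hX g).mul hA₁ (hCb₂ i c' hc')
  have hvb := bddBy_of_mem_hull_modulated hA₁ (hCb₁ i) (hHb₁ i) hv (a n)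
  have e' : actionTranslate n f = actionTranslate (b n) (actionTranslate (a n) f) := by
    rw [← actionTranslate_add, add_comm, ← e]
  rw [e']
  refine (l1Dist_triangle (((hFb i f hf).translate hX _).translate hX _)
    (hvb.translate hX (b n)) hwb).trans ?_
  rw [l1Dist_translate hX]
  have h3 := hfv ζ' h0' (hζ'.trans (min_le_left _ _)) _ ha
  have h4 := hvw n hnN
  have h5 : A₁ * (κ / (2 * (A₁ + 1))) ≤ κ / 2 := by
    rw [mul_div_assoc', div_le_div_iff₀ (by positivity) (by positivity)]
    nlinarith
  linarith
termination_by d₁ + d₂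

/-! ### Approximate shift invariance of boxes and coset progressions. -/

section BoxShift

variable {ι : Type*} [Fintype ι] [DecidableEq ι]

/-- All fibres of a box over the values of one coordinate have the same size. -/
theorem card_filter_piFinset_mem (t : ι → Finset ℤ) (i : ι) {A : Finset ℤ} (hA : A ⊆ t i) :
    ((Fintype.piFinset t).filter fun m => m i ∈ A).card * (t i).card =
      A.card * (Fintype.piFinset t).card := by
  have h1 : ((Fintype.piFinset t).filter fun m => m i ∈ A).card =
      ∑ a ∈ A, ((Fintype.piFinset t).filter fun m => m i = a).card := by
    rw [Finset.card_eq_sum_card_fiberwise (f := fun m => m i) (t := A)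
      (by intro m hm; exact (Finset.mem_filter.1 hm).2)]
    refine Finset.sum_congr rfl fun a ha => ?_
    rw [Finset.filter_filter]
    congr 1
    refine Finset.filter_congr fun m _ => ?_
    constructor
    · exact fun h => h.2
    · rintro rfl
      exact ⟨ha, rfl⟩
  have h2 : ∀ a ∈ A, ((Fintype.piFinset t).filter fun m => m i = a).card =
      ∏ j ∈ Finset.univ.erase i, (t j).card := fun a ha => by
    rw [Fintype.card_filter_piFinset_eq_of_mem _ _ (hA ha)]
  rw [h1, Finset.sum_congr rfl h2, Finset.sum_const, smul_eq_mul, Fintype.card_piFinset,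
    ← Finset.mul_prod_erase Finset.univ _ (Finset.mem_univ i)]
  ring

theorem card_filter_shift_le (M k : ℤ) :
    ((Finset.Icc (-M) M).filter fun a => a + k ∉ Finset.Icc (-M) M).card ≤ k.natAbs := by
  rcases le_total 0 k with hk | hk
  · calc _ ≤ (Finset.Ioc (M - k) M).card := Finset.card_le_card fun a ha => by
          simp only [Finset.mem_filter, Finset.mem_Icc, Finset.mem_Ioc] at ha ⊢
          omega
      _ ≤ _ := by
        rw [Int.card_Ioc]
        omega
  · calc _ ≤ (Finset.Ico (-M) (-M - k)).card := Finset.card_le_card fun a ha => by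
          simp only [Finset.mem_filter, Finset.mem_Icc, Finset.mem_Ico] at ha ⊢
          omega
      _ ≤ _ := by
        rw [Int.card_Ico]
        omega

/-- The terms that stay in the box cancel bijectively. What remains are two boundary layers, each of
relative size at most `ρ`. -/
theorem norm_sum_piFinset_shift_sub_le (M : ι → ℤ) (hM : ∀ j, 0 ≤ M j) (i : ι) (k : ℤ) {ρ : ℝ}
    (hk : (k.natAbs : ℝ) ≤ ρ * (2 * M i + 1)) {Φ : (ι → ℤ) → ℂ} (hΦ : ∀ m, ‖Φ m‖ ≤ 1) :
    ‖(∑ m ∈ Fintype.piFinset fun j => Finset.Icc (-M j) (M j), Φ (m + Pi.single i k)) -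
      ∑ m ∈ Fintype.piFinset fun j => Finset.Icc (-M j) (M j), Φ m‖ ≤
      2 * ρ * (Fintype.piFinset fun j => Finset.Icc (-M j) (M j)).card := by
  set t : ι → Finset ℤ := fun j => Finset.Icc (-M j) (M j) with ht
  set B := Fintype.piFinset t with hB
  have hmem : ∀ m ∈ B, ∀ l : ℤ, m + Pi.single i l ∈ B ↔ m i + l ∈ t i := by
    intro m hm l
    rw [hB, Fintype.mem_piFinset] at hm ⊢
    constructor
    · intro h
      simpa using h i
    · intro h j
      rcases eq_or_ne j i with rfl | hj
      · simpa using h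
      · simpa [hj] using hm j
  have hbound : ∀ l : ℤ, l.natAbs = k.natAbs →
      ((B.filter fun m => m + Pi.single i l ∉ B).card : ℝ) ≤ ρ * B.card := by
    intro l hl
    have h1 : (B.filter fun m => m + Pi.single i l ∉ B) =
        B.filter fun m => m i ∈ (t i).filter fun a => a + l ∉ t i := by
      refine Finset.filter_congr fun m hm => ?_
      rw [hmem m hm, Finset.mem_filter]
      exact ⟨fun h => ⟨Fintype.mem_piFinset.1 hm i, h⟩, fun h => h.2⟩
    have h2 := card_filter_piFinset_mem t i
      (Finset.filter_subset (fun a => a + l ∉ t i) (t i))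
    have h3 : (((t i).filter fun a => a + l ∉ t i).card : ℝ) ≤ ρ * (2 * M i + 1) := by
      refine le_trans ?_ hk
      rw [← hl]
      exact_mod_cast card_filter_shift_le (M i) l
    have h4 : ((t i).card : ℝ) = 2 * M i + 1 := by
      have h5 : ((t i).card : ℤ) = 2 * M i + 1 := by
        have := hM i
        rw [ht, Int.card_Icc]
        omega
      exact_mod_cast congrArg (Int.cast : ℤ → ℝ) h5
    have h6 : (0 : ℝ) < 2 * M i + 1 := by
      have : (0 : ℝ) ≤ M i := by exact_mod_cast hM i
      positivity
    rw [h1]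
    have h7 : ((B.filter fun m => m i ∈ (t i).filter fun a => a + l ∉ t i).card : ℝ) *
        (2 * M i + 1) = ((t i).filter fun a => a + l ∉ t i).card * B.card := by
      rw [← h4]
      exact_mod_cast h2
    refine le_of_mul_le_mul_right ?_ h6
    rw [h7]
    calc _ ≤ ρ * (2 * M i + 1) * B.card := mul_le_mul_of_nonneg_right h3 (by positivity)
      _ = _ := by ring
  have hsum : ∀ (l : ℤ), l.natAbs = k.natAbs → ∀ Ψ : (ι → ℤ) → ℂ, (∀ m, ‖Ψ m‖ ≤ 1) →
      ‖∑ m ∈ B.filter (fun m => m + Pi.single i l ∉ B), Ψ m‖ ≤ ρ * B.card := by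
    intro l hl Ψ hΨ
    refine (norm_sum_le_of_le _ fun m _ => hΨ m).trans ?_
    simpa using hbound l hl
  have hbij : ∑ m ∈ B.filter (fun m => m + Pi.single i k ∈ B), Φ (m + Pi.single i k) =
      ∑ m ∈ B.filter (fun m => m + Pi.single i (-k) ∈ B), Φ m := by
    refine Finset.sum_bij' (fun m _ => m + Pi.single i k) (fun m _ => m + Pi.single i (-k))
      ?_ ?_ ?_ ?_ ?_
    · intro m hm
      rw [Finset.mem_filter] at hm ⊢
      refine ⟨hm.2, ?_⟩
      rw [add_assoc, ← Pi.single_add]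
      simpa using hm.1
    · intro m hm
      rw [Finset.mem_filter] at hm ⊢
      refine ⟨hm.2, ?_⟩
      rw [add_assoc, ← Pi.single_add]
      simpa using hm.1
    · intro m _
      rw [add_assoc, ← Pi.single_add]
      simp
    · intro m _
      rw [add_assoc, ← Pi.single_add]
      simp
    · intro m _
      rfl
  have e1 := Finset.sum_filter_add_sum_filter_not B (fun m : ι → ℤ => m + Pi.single i k ∈ B)
    (fun m : ι → ℤ => Φ (m + Pi.single i k))
  have e2 := Finset.sum_filter_add_sum_filter_not B (fun m : ι → ℤ => m + Pi.single i (-k) ∈ B) Φ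
  rw [← e1, ← e2, hbij, add_sub_add_left_eq_sub]
  refine (norm_sub_le _ _).trans ?_
  have h1 := hsum k rfl (fun m => Φ (m + Pi.single i k)) fun _ => hΦ _
  have h2 := hsum (-k) (by simp) Φ hΦ
  linarith

end BoxShift

/-- The shift is performed one coordinate at a time, at a cost of `2 * (η / ε)` each. -/
theorem norm_vectorAvg_integerBox_shift_sub_le {r : ℕ} (N : Fin r → ℝ) (hN : ∀ i, 0 < N i)
    {ε η : ℝ} (hε : 0 < ε) (hη : 0 < η) (hle : η ≤ ε) {m₀ : Fin r → ℤ}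
    (hm₀ : ∀ i, |(m₀ i : ℝ)| ≤ η * N i) {Φ : (Fin r → ℤ) → ℂ} (hΦ : ∀ m, ‖Φ m‖ ≤ 1) :
    ‖vectorAvg (integerBox fun i => ε * N i).val (fun m => Φ (m + m₀)) -
      vectorAvg (integerBox fun i => ε * N i).val Φ‖ ≤ 2 * r * (η / ε) := by
  set M : Fin r → ℤ := fun i => ⌊ε * N i⌋ with hM
  have hM0 : ∀ i, 0 ≤ M i := fun i => Int.floor_nonneg.2 (mul_nonneg hε.le (hN i).le)
  have hk : ∀ i, ((m₀ i).natAbs : ℝ) ≤ η / ε * (2 * M i + 1) := by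
    intro i
    have h0 : (0 : ℝ) ≤ M i := by exact_mod_cast hM0 i
    rw [Nat.cast_natAbs, Int.cast_abs]
    rcases eq_or_ne (m₀ i) 0 with h | h
    · rw [h]
      simp only [Int.cast_zero, abs_zero]
      positivity
    · have h1 : (1 : ℝ) ≤ |(m₀ i : ℝ)| := by exact_mod_cast Int.one_le_abs h
      have h2 := hm₀ i
      have h3 : ε * N i < M i + 1 := Int.lt_floor_add_one _
      have h4 : η * N i ≤ ε * N i := mul_le_mul_of_nonneg_right hle (hN i).le
      rw [div_mul_eq_mul_div, le_div_iff₀ hε]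
      have h5 : ε * N i ≤ 2 * M i + 1 := by linarith
      nlinarith
  set B := Fintype.piFinset fun j => Finset.Icc (-M j) (M j) with hB
  have hbox : (integerBox fun i => ε * N i) = B := rfl
  rw [hbox]
  have hBpos : (0 : ℝ) < B.card := by
    have : (0 : Fin r → ℤ) ∈ B := by
      rw [hB, Fintype.mem_piFinset]
      intro i
      simp [hM0 i]
    exact_mod_cast Finset.card_pos.2 ⟨_, this⟩
  have key : ∀ s : Finset (Fin r),
      ‖(∑ m ∈ B, Φ (m + ∑ i ∈ s, Pi.single i (m₀ i))) - ∑ m ∈ B, Φ m‖ ≤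
        2 * s.card * (η / ε) * B.card := by
    intro s
    induction s using Finset.induction_on with
    | empty => simp
    | insert i s hi ih =>
      have h1 := norm_sum_piFinset_shift_sub_le M hM0 i (m₀ i) (hk i)
        (Φ := fun m => Φ (m + ∑ i ∈ s, Pi.single i (m₀ i))) fun _ => hΦ _
      rw [Finset.sum_insert hi, Finset.card_insert_of_notMem hi]
      simp only [add_assoc] at h1 ⊢
      refine (norm_sub_le_norm_sub_add_norm_sub _ _ _).trans ((add_le_add h1 ih).trans_eq ?_)
      push_cast
      ring
  have h1 := key Finset.univ
  rw [Finset.univ_sum_single, Finset.card_univ, Fintype.card_fin] at h1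
  simp only [vectorAvg, Finset.card_val, ← smul_sub]
  rw [norm_smul, norm_inv, Real.norm_of_nonneg hBpos.le, inv_mul_le_iff₀ hBpos, mul_comm]
  exact h1

namespace CosetProgression

variable {G : Type u} [AddCommGroup G] {r : ℕ}

theorem vectorAvg_toMultiset (Q : CosetProgression G r) (φ : G → ℂ) :
    vectorAvg Q.toMultiset φ = vectorAvg Q.finite_H.toFinset.val fun h =>
      vectorAvg (integerBox Q.N).val fun m => φ (h + ∑ i, m i • Q.v i) := by
  have hn : ∀ (A : Multiset G) (F : G → ℂ), vectorAvg (Q.mult • A) F = vectorAvg A F := by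
    intro A F
    have : (Q.mult : ℝ) ≠ 0 := by exact_mod_cast Q.mult_pos.ne'
    simp only [vectorAvg, Multiset.card_nsmul, Multiset.map_nsmul, Multiset.sum_nsmul,
      ← Nat.cast_smul_eq_nsmul ℝ, smul_smul]
    congr 1
    push_cast
    field_simp
  rw [toMultiset, sumset, vectorAvg_map, vectorAvg_product, hn]
  simp only [vectorAvg_map]

theorem mem_toMultiset {Q : CosetProgression G r} {n : G} :
    n ∈ Q.toMultiset ↔ ∃ h ∈ Q.H, ∃ m ∈ integerBox Q.N, n = h + ∑ i, m i • Q.v i := by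
  simp only [toMultiset, sumset, Multiset.mem_map, Multiset.mem_product,
    Multiset.mem_nsmul_of_ne_zero Q.mult_pos.ne', Finset.mem_val, Set.Finite.mem_toFinset,
    SetLike.mem_coe, Prod.exists]
  constructor
  · rintro ⟨a, b, ⟨ha, m, hm, rfl⟩, rfl⟩
    exact ⟨a, ha, m, hm, rfl⟩
  · rintro ⟨a, ha, m, hm, rfl⟩
    exact ⟨a, _, ⟨ha, m, hm, rfl⟩, rfl⟩

theorem toMultiset_ne_zero (Q : CosetProgression G r) : Q.toMultiset ≠ 0 := by
  have : (0 : G) ∈ Q.toMultiset := mem_toMultiset.2 ⟨0, Q.H.zero_mem, 0,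
    (mem_integerBox _ _).2 fun i => by simpa using (Q.N_pos i).le, by simp⟩
  intro h
  simp [h] at this

/-- The component of `n` in the subgroup is absorbed exactly; only the box component produces an
error. -/
theorem norm_vectorAvg_shift_sub_le (Q : CosetProgression G r) {ε η : ℝ} (hε : 0 < ε)
    (hη : 0 < η) (hle : η ≤ ε) {n : G} (hn : n ∈ (Q.dilate η hη).toMultiset) {φ : G → ℂ}
    (hφ : ∀ g, ‖φ g‖ ≤ 1) :
    ‖vectorAvg (Q.dilate ε hε).toMultiset (fun h => φ (h + n)) -
      vectorAvg (Q.dilate ε hε).toMultiset φ‖ ≤ 2 * r * (η / ε) := by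
  obtain ⟨h₀, hh₀, m₀, hm₀, rfl⟩ := mem_toMultiset.1 hn
  rw [mem_integerBox] at hm₀
  have hH : ∀ F : G → ℂ, vectorAvg Q.finite_H.toFinset.val (fun h => F (h + h₀)) =
      vectorAvg Q.finite_H.toFinset.val F := by
    intro F
    simp only [vectorAvg]
    congr 1
    refine Finset.sum_bij' (fun h _ => h + h₀) (fun h _ => h - h₀) ?_ ?_ ?_ ?_ ?_
    · intro h hh
      simp only [Set.Finite.mem_toFinset, SetLike.mem_coe] at hh ⊢
      exact Q.H.add_mem hh hh₀
    · intro h hh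
      simp only [Set.Finite.mem_toFinset, SetLike.mem_coe] at hh ⊢
      exact Q.H.sub_mem hh hh₀
    · intro h _
      exact add_sub_cancel_right _ _
    · intro h _
      exact sub_add_cancel _ _
    · intro h _
      rfl
  rw [vectorAvg_toMultiset, vectorAvg_toMultiset]
  change ‖vectorAvg Q.finite_H.toFinset.val (fun h =>
      vectorAvg (integerBox fun i => ε * Q.N i).val fun m =>
        φ (h + ∑ i, m i • Q.v i + (h₀ + ∑ i, m₀ i • Q.v i))) -
    vectorAvg Q.finite_H.toFinset.val (fun h =>
      vectorAvg (integerBox fun i => ε * Q.N i).val fun m => φ (h + ∑ i, m i • Q.v i))‖ ≤ _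
  rw [← hH fun h => vectorAvg (integerBox fun i => ε * Q.N i).val fun m =>
    φ (h + ∑ i, m i • Q.v i), vectorAvg_sub]
  refine norm_vectorAvg_le _ (by positivity) fun h _ => ?_
  have := norm_vectorAvg_integerBox_shift_sub_le Q.N Q.N_pos hε hη hle hm₀
    (Φ := fun m => φ (h + h₀ + ∑ i, m i • Q.v i)) fun _ => hφ _
  have e : (fun m : Fin r → ℤ => φ (h + ∑ i, m i • Q.v i + (h₀ + ∑ i, m₀ i • Q.v i))) =
      fun m => φ (h + h₀ + ∑ i, (m + m₀) i • Q.v i) := by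
    funext m
    simp only [Pi.add_apply, add_smul, Finset.sum_add_distrib]
    congr 1
    abel
  rw [e]
  exact this

end CosetProgression

/-! ### From dual quantities to anti-uniform classes. -/

section Dual

variable {G : Type u} [AddCommGroup G] {X : Type v} [MeasurableSpace X] [AddAction G X]
  {μ : Measure X}

theorem exists_bddBy_ae_eq {f : X → ℂ} (hf : MemLp f ∞ μ) (h1 : eLpNorm f ∞ μ ≤ 1) :
    ∃ f', BddBy 1 f' ∧ f =ᵐ[μ] f' := by
  refine ⟨fun x => discRetraction (hf.1.mk f x),
    ⟨continuous_discRetraction.measurable.comp hf.1.stronglyMeasurable_mk.measurable,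
      fun x => norm_discRetraction_le _⟩, ?_⟩
  rw [eLpNorm_exponent_top] at h1
  filter_upwards [hf.1.ae_eq_mk, ae_le_eLpNormEssSup (f := f) (μ := μ)] with x hx hle
  have h2 : ‖f x‖ ≤ 1 := by
    have := hle.trans h1
    rwa [← ofReal_norm, ENNReal.ofReal_le_one] at this
  rw [← hx, discRetraction, max_eq_left h2, inv_one, one_smul]

theorem gowersAvg_congr_ae (hX : IsGSystem G μ) (Q : Multiset G) (d : ℕ) {f f' : X → ℂ}
    (h : f =ᵐ[μ] f') : gowersAvg μ Q d f = gowersAvg μ Q d f' := by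
  induction d generalizing f f' with
  | zero => exact integral_congr_ae h
  | succ d ih =>
    rw [gowersAvg_succ, gowersAvg_succ]
    refine vectorAvg_congr fun p _ => ih ?_
    have ht : ∀ g : G, actionTranslate g f =ᵐ[μ] actionTranslate g f' := fun g =>
      (hX.measurePreserving (-g)).quasiMeasurePreserving.ae_eq_comp h
    filter_upwards [ht p.1, ht p.2] with x h1 h2
    simp only [gowersDelta, h1, h2]

theorem gowersNorm_le_iff (Q : Multiset G) (d : ℕ) (f : X → ℂ) {ε : ℝ} (hε : 0 ≤ ε) :
    gowersNorm μ d Q f ≤ ε ↔ ‖gowersAvg μ Q d f‖ ≤ ε ^ 2 ^ d := by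
  have h : gowersNorm μ d Q f ^ 2 ^ d = ‖gowersAvg μ Q d f‖ := by
    rw [gowersNorm, ← Real.rpow_natCast, ← Real.rpow_mul (norm_nonneg _)]
    simp
  have h0 : 0 ≤ gowersNorm μ d Q f := Real.rpow_nonneg (norm_nonneg _) _
  rw [← h, pow_le_pow_iff_left₀ h0 hε (by positivity)]

theorem gowersDual_congr_ae {r : ℕ} {d : ℕ} (Q : CosetProgression G r) {f f' : X → ℂ}
    (h : f =ᵐ[μ] f') (ε : ℝ) (hε : 0 < ε) :
    gowersDual μ d Q f ε hε = gowersDual μ d Q f' ε hε := by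
  have e : ∀ g : X → ℂ, ∫ x, f x * conj (g x) ∂μ = ∫ x, f' x * conj (g x) ∂μ := fun g =>
    integral_congr_ae (h.mono fun x hx => by simp only [hx])
  simp only [gowersDual, e]

/-- Replacing a test function by an everywhere bounded measurable representative changes neither its
Gowers average nor its correlation with `f`. -/
theorem gowersDual_le_ofReal_iff (hX : IsGSystem G μ) {r d : ℕ} (Q : CosetProgression G r)
    (f : X → ℂ) {ε δ : ℝ} (hε : 0 < ε) (hδ : 0 ≤ δ) :
    gowersDual μ d Q f ε hε ≤ ENNReal.ofReal δ ↔ ∀ g, BddBy 1 g →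
      ‖gowersAvg μ (Q.dilate ε hε).toMultiset d g‖ ≤ ε ^ 2 ^ d →
        ‖∫ x, f x * conj (g x) ∂μ‖ ≤ δ := by
  have := hX.isProbabilityMeasure
  simp only [gowersDual, iSup_le_iff, gowersNorm_le_iff _ _ _ hε.le, ← ofReal_norm,
    ENNReal.ofReal_le_ofReal_iff hδ]
  constructor
  · intro h g hg hgU
    refine h g hg.memLp ?_ hgU
    rw [eLpNorm_exponent_top]
    refine eLpNormEssSup_le_of_ae_bound (C := 1) (.of_forall hg.2) |>.trans ?_
    simp
  · intro h g hg hg1 hgU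
    obtain ⟨g', hg', hgg'⟩ := exists_bddBy_ae_eq hg hg1
    rw [gowersAvg_congr_ae hX _ _ hgg'] at hgU
    have e : ∫ x, f x * conj (g x) ∂μ = ∫ x, f x * conj (g' x) ∂μ :=
      integral_congr_ae (hgg'.mono fun x hx => by simp only [hx])
    rw [e]
    exact h g' hg' hgU

end Dual

/-- The averaging multisets given by the dilates of coset progressions of bounded rank. -/
def progressionScale {I : Type w} {S : I → SystemData.{u, v}} {r : ℕ}
    (Q : ∀ i, CosetProgression (S i).G r) : ScaleFamily S where
  Q := fun i ε => if hε : 0 < ε then ((Q i).dilate ε hε).toMultiset else {0}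
  ne_zero := fun i ε => by
    split_ifs with hε
    · exact CosetProgression.toMultiset_ne_zero _
    · simp
  shift := fun ε hε κ hκ => by
    refine ⟨min ε (κ * ε / (2 * (r + 1))), by positivity, fun η hη hle i n hn φ hφ => ?_⟩
    rw [dif_pos hη] at hn
    rw [dif_pos hε]
    refine ((Q i).norm_vectorAvg_shift_sub_le hε hη (hle.trans (min_le_left _ _)) hn hφ).trans ?_
    have h := hle.trans (min_le_right _ _)
    rw [le_div_iff₀ (by positivity)] at h
    rw [mul_div_assoc', div_le_iff₀ hε]
    nlinarith

theorem progressionScale_apply {I : Type w} {S : I → SystemData.{u, v}} {r : ℕ}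
    (Q : ∀ i, CosetProgression (S i).G r) (i : I) {ε : ℝ} (hε : 0 < ε) :
    (progressionScale Q).Q i ε = ((Q i).dilate ε hε).toMultiset := dif_pos hε

theorem antiUniform_progressionScale {I : Type w} {S : I → SystemData.{u, v}} {r d : ℕ}
    (Q : ∀ i, CosetProgression (S i).G r) {c : ℝ → ℝ} (hc : Tendsto c (𝓝[>] 0) (𝓝 0))
    {F : FunctionClass S} (hF : UniformlyBdd F)
    (h : ∀ i, ∀ f ∈ F i, ∀ (ε : ℝ) (hε : 0 < ε),
      gowersDual (S i).μ (d + 1) (Q i) f ε hε ≤ ENNReal.ofReal (c ε)) :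
    AntiUniform (progressionScale Q) (d + 1) F := by
  refine ⟨hF, fun δ hδ => ?_⟩
  have hev : ∀ᶠ ε in 𝓝[>] (0 : ℝ), c ε < δ := hc.eventually (gt_mem_nhds hδ)
  obtain ⟨ε₀, hε₀, hsub⟩ := mem_nhdsGT_iff_exists_Ioc_subset.1 hev
  refine ⟨ε₀, hε₀, fun ε hε hle i f hf g hg hgU => ?_⟩
  rw [progressionScale_apply Q i hε] at hgU
  have hcε : c ε < δ := hsub ⟨hε, hle⟩
  exact (gowersDual_le_ofReal_iff (S i).isGSystem (Q i) f hε hδ.le).1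
    ((h i f hf ε hε).trans (ENNReal.ofReal_le_ofReal hcε.le)) g hg hgU

/-- The index set runs over all systems with all pairs of progressions, and the class contains all
functions obeying the two given bounds. One application of concatenation therefore gives an `ε₀`
depending only on the orders, ranks, `c₁`, `c₂` and `δ`. -/
theorem exists_gowersDual_add_le (d₁ d₂ r₁ r₂ : ℕ) (c₁ c₂ : ℝ → ℝ)
    (hc₁ : Tendsto c₁ (𝓝[>] 0) (𝓝 0)) (hc₂ : Tendsto c₂ (𝓝[>] 0) (𝓝 0)) (δ : ℝ) (hδ : 0 < δ) :
    ∃ ε₀ : ℝ, 0 < ε₀ ∧ ∀ (ε : ℝ) (hε : 0 < ε), ε ≤ ε₀ →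
      ∀ (G : Type u) [AddCommGroup G] (X : Type v) [MeasurableSpace X] [AddAction G X]
        (μ : Measure X), IsGSystem G μ →
        ∀ (Q₁ : CosetProgression G r₁) (Q₂ : CosetProgression G r₂) (f : X → ℂ), BddBy 1 f →
          (∀ (ε : ℝ) (hε : 0 < ε),
            gowersDual μ (d₁ + 1) Q₁ f ε hε ≤ ENNReal.ofReal (c₁ ε)) →
          (∀ (ε : ℝ) (hε : 0 < ε),
            gowersDual μ (d₂ + 1) Q₂ f ε hε ≤ ENNReal.ofReal (c₂ ε)) →
          gowersDual μ (d₁ + d₂ + 1) (Q₁.add Q₂) f ε hε ≤ ENNReal.ofReal δ := by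
  let I := Σ s : SystemData.{u, v}, CosetProgression s.G r₁ × CosetProgression s.G r₂
  let S : I → SystemData.{u, v} := fun i => i.1
  let F : FunctionClass S := fun i => {f | BddBy 1 f ∧
    (∀ (ε : ℝ) (hε : 0 < ε), gowersDual (S i).μ (d₁ + 1) i.2.1 f ε hε ≤ ENNReal.ofReal (c₁ ε)) ∧
    ∀ (ε : ℝ) (hε : 0 < ε), gowersDual (S i).μ (d₂ + 1) i.2.2 f ε hε ≤ ENNReal.ofReal (c₂ ε)}
  have hF : UniformlyBdd F := ⟨1, zero_le_one, fun i f hf => hf.1⟩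
  have h₁ : AntiUniform (progressionScale (S := S) fun i => i.2.1) (d₁ + 1) F :=
    antiUniform_progressionScale _ hc₁ hF fun i f hf => hf.2.1
  have h₂ : AntiUniform (progressionScale (S := S) fun i => i.2.2) (d₂ + 1) F :=
    antiUniform_progressionScale _ hc₂ hF fun i f hf => hf.2.2
  have h₃ : AntiUniform (progressionScale (S := S) fun i => i.2.1.add i.2.2) (d₁ + d₂ + 1) F := by
    refine AntiUniform.concatenation (fun i η hη n hn => ?_) d₁ d₂ h₁ h₂
    rw [progressionScale_apply _ i hη] at hn ⊢
    rw [progressionScale_apply _ i hη]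
    rw [CosetProgression.dilate_add, CosetProgression.toMultiset_add, sumset,
      Multiset.mem_map] at hn
    obtain ⟨⟨a, b⟩, hab, rfl⟩ := hn
    rw [Multiset.mem_product] at hab
    exact ⟨a, hab.1, b, hab.2, rfl⟩
  obtain ⟨ε₀, hε₀, h⟩ := h₃.2 δ hδ
  refine ⟨ε₀, hε₀, fun ε hε hle G _ X _ _ μ hX Q₁ Q₂ f hf hf₁ hf₂ => ?_⟩
  let i : I := ⟨{ G := G, X := X, μ := μ, isGSystem := hX }, Q₁, Q₂⟩
  refine (gowersDual_le_ofReal_iff hX _ f hε hδ.le).2 fun g hg hgU => ?_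
  refine h ε hε hle i f ⟨hf, hf₁, hf₂⟩ g hg ?_
  rw [progressionScale_apply _ i hε]
  exact hgU

end

/-! ### Choice of the function `c`. -/

theorem theorem1p6 (d₁ d₂ r₁ r₂ : ℕ) (hd₁ : 0 < d₁) (hd₂ : 0 < d₂)
    (c₁ c₂ : ℝ → ℝ) (hc₁_pos : ∀ ε : ℝ, 0 < ε → 0 < c₁ ε) (hc₂_pos : ∀ ε : ℝ, 0 < ε → 0 < c₂ ε)
    (hc₁ : Tendsto c₁ (𝓝[>] 0) (𝓝 0)) (hc₂ : Tendsto c₂ (𝓝[>] 0) (𝓝 0)) :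
    ∃ c : ℝ → ℝ, (∀ ε : ℝ, 0 < ε → 0 < c ε) ∧ Tendsto c (𝓝[>] 0) (𝓝 0) ∧
      ∀ (G : Type u) [AddCommGroup G] [Countable G]
        (X : Type v) [MeasurableSpace X] [AddAction G X] (μ : Measure X),
        IsGSystem G μ →
        ∀ (Q₁ : CosetProgression G r₁) (Q₂ : CosetProgression G r₂) (f : X → ℂ),
          MemLp f ∞ μ → eLpNorm f ∞ μ ≤ 1 →
          (∀ (ε : ℝ) (hε : 0 < ε), gowersDual μ d₁ Q₁ f ε hε ≤ ENNReal.ofReal (c₁ ε)) →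
          (∀ (ε : ℝ) (hε : 0 < ε), gowersDual μ d₂ Q₂ f ε hε ≤ ENNReal.ofReal (c₂ ε)) →
          ∀ (ε : ℝ) (hε : 0 < ε),
            gowersDual μ (d₁ + d₂ - 1) (Q₁.add Q₂) f ε hε ≤ ENNReal.ofReal (c ε) := by
  obtain ⟨e₁, rfl⟩ := Nat.exists_eq_add_of_lt hd₁
  obtain ⟨e₂, rfl⟩ := Nat.exists_eq_add_of_lt hd₂
  have hd : e₁ + 1 + (e₂ + 1) - 1 = e₁ + e₂ + 1 := by omega
  simp only [zero_add, hd]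
  -- `A ε` is the set of bounds valid for all systems at scale `ε`. Adding `ε` to its infimum makes
  -- `c` positive and leaves room for an element of `A ε` below `c ε`, as the infimum need not be
  -- attained.
  let A : ℝ → Set ℝ := fun ε => {δ | 0 < δ ∧ ∀ (hε : 0 < ε) (G : Type u) [AddCommGroup G]
    (X : Type v) [MeasurableSpace X] [AddAction G X] (μ : Measure X), IsGSystem G μ →
    ∀ (Q₁ : CosetProgression G r₁) (Q₂ : CosetProgression G r₂) (f : X → ℂ), BddBy 1 f →
      (∀ (ε : ℝ) (hε : 0 < ε), gowersDual μ (e₁ + 1) Q₁ f ε hε ≤ ENNReal.ofReal (c₁ ε)) →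
      (∀ (ε : ℝ) (hε : 0 < ε), gowersDual μ (e₂ + 1) Q₂ f ε hε ≤ ENNReal.ofReal (c₂ ε)) →
      gowersDual μ (e₁ + e₂ + 1) (Q₁.add Q₂) f ε hε ≤ ENNReal.ofReal δ}
  have hone : ∀ ε, (1 : ℝ) ∈ A ε := fun ε => by
    refine ⟨one_pos, fun hε G _ X _ _ μ hX Q₁ Q₂ f hf _ _ => ?_⟩
    have := hX.isProbabilityMeasure
    refine (gowersDual_le_ofReal_iff hX _ f hε zero_le_one).2 fun g hg _ => ?_
    simpa using (hf.mul zero_le_one hg.star).norm_integral_le (μ := μ)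
  have hbdd : ∀ ε, BddBelow (A ε) := fun ε => ⟨0, fun δ hδ => hδ.1.le⟩
  have hnn : ∀ ε, 0 ≤ sInf (A ε) := fun ε => Real.sInf_nonneg fun δ hδ => hδ.1.le
  refine ⟨fun ε => sInf (A ε) + ε, fun ε hε => add_pos_of_nonneg_of_pos (hnn ε) hε, ?_, ?_⟩
  · have hid : Tendsto (fun ε : ℝ => ε) (𝓝[>] 0) (𝓝 0) := 
      tendsto_nhdsWithin_of_tendsto_nhds tendsto_id
    have hs : Tendsto (fun ε => sInf (A ε)) (𝓝[>] 0) (𝓝 0) := by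
      rw [Metric.tendsto_nhds]
      intro δ hδ
      obtain ⟨ε₀, hε₀, h⟩ := exists_gowersDual_add_le.{u, v} e₁ e₂ r₁ r₂ c₁ c₂ hc₁ hc₂ (δ / 2)
        (by positivity)
      filter_upwards [Ioc_mem_nhdsGT hε₀] with ε hε
      have hmem : δ / 2 ∈ A ε := ⟨by positivity, fun hε' => h ε hε' hε.2⟩
      rw [Real.dist_0_eq_abs, abs_of_nonneg (hnn ε)]
      linarith [csInf_le (hbdd ε) hmem]
    simpa using hs.add hid
  · intro G _ _ X _ _ μ hX Q₁ Q₂ f hf hf1 h₁ h₂ ε hε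
    obtain ⟨f', hf', hff'⟩ := exists_bddBy_ae_eq hf hf1
    simp only [gowersDual_congr_ae _ hff'] at h₁ h₂ ⊢
    obtain ⟨δ, hδ, hlt⟩ := exists_lt_of_csInf_lt ⟨1, hone ε⟩
      (lt_add_of_pos_right (sInf (A ε)) hε)
    exact (hδ.2 hε G X μ hX Q₁ Q₂ f' hf' h₁ h₂).trans (ENNReal.ofReal_le_ofReal hlt.le)
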